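/- Let $\mathcal L$ be a locally finite collection of complete geodesics (lines) in the hyperbolic plane $\mathbb H^2$ such that all complementary regions of $\bigcup_{L\in\mathcal L}L$ (the connected components of its complement) are bounded, and let $\Gamma\subset \mathrm{Isom}(\mathbb H^2)$ be a cocompact lattice stabilizing $\mathcal L$, i.e. $\gamma(\mathcal L)=\mathcal L$ for all $\gamma\in\Gamma$. For a geodesic $L$ let $\partial_\infty L\subset\partial_\infty\mathbb H^2$ be its pair of endpoints, let $\partial_\infty\mathcal L=\{\partial_\infty L\mid L\in\mathcal L\}$, and let $\mathrm{Stab}(\partial_\infty\mathcal L)$ be the group of homeomorphisms $g$ of the circle $\partial_\infty\mathbb H^2$ such that $g(\partial_\infty\mathcal L)=\partial_\infty\mathcal L$. For an isometry $\gamma$ let $\partial_\infty\gamma$ be the homeomorphism of $\partial_\infty\mathbb H^2$ by which $\gamma$ extends continuously to the boundary. Then: 1. If $L_1,L_2\in\mathcal L$ are distinct lines with $L_1\cap L_2\neq\emptyset$, and $g\in\mathrm{Stab}(\partial_\infty\mathcal L)$ fixes $\partial_\infty L_1\cup\partial_\infty L_2$ pointwise, then $g=\mathrm{id}$. 2. Every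 $\gamma\in\Gamma$ has a unique continuous boundary extension $\partial_\infty\gamma$, and $\{\partial_\infty\gamma\mid\gamma\in\Gamma\}$ is a subgroup of finite index in $\mathrm{Stab}(\partial_\infty\mathcal L)$. -/

import Mathlib

open UpperHalfPlane Topology Filter

namespace HypPlane

/-- A complete geodesic (line) of the hyperbolic plane: the image of an isometric
embedding of the real line. -/
def IsGeodesicLine (L : Set ℍ) : Prop :=
  ∃ c : ℝ → ℍ, Isometry c ∧ Set.range c = L

/-- The ideal boundary of the upper half-plane: the circle `ℝ ∪ {∞}`. -/
abbrev Boundary : Type := OnePoint ℝ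

/-- The open upper half-plane inside the Riemann sphere `ℂ ∪ {∞}`. -/
def toSphere (z : ℍ) : OnePoint ℂ := ((z : ℂ) : OnePoint ℂ)

/-- The ideal boundary circle `ℝ ∪ {∞}` inside the Riemann sphere `ℂ ∪ {∞}`. -/
def boundaryToSphere (ξ : Boundary) : OnePoint ℂ := OnePoint.map ((↑) : ℝ → ℂ) ξ

/-- The points at infinity of a subset of the hyperbolic plane. For a geodesic line this is
the pair of its endpoints. -/
def ideal (A : Set ℍ) : Set Boundary :=
  {ξ | boundaryToSphere ξ ∈ closure (toSphere '' A)}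

/-- The homeomorphism `f` of the ideal boundary extends the isometry `γ` continuously:
`γ z → f ξ` whenever `z ∈ ℍ` tends to the ideal point `ξ`. -/
def IsBoundaryMap (γ : ℍ ≃ᵢ ℍ) (f : Boundary ≃ₜ Boundary) : Prop :=
  ∀ ξ : Boundary, Tendsto (fun z : ℍ => toSphere (γ z))
    (comap toSphere (𝓝 (boundaryToSphere ξ))) (𝓝 (boundaryToSphere (f ξ)))

/-- A cocompact lattice in the group of all isometries of the hyperbolic plane: a subgroup which
is discrete (in the compact-open topology) and such that the translates of some compact set
cover the plane. -/
structure IsCocompactLattice (Γ : Subgroup (ℍ ≃ᵢ ℍ)) : Prop where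
  discrete : IsDiscrete ((fun γ : ℍ ≃ᵢ ℍ => (⟨γ, γ.continuous⟩ : C(ℍ, ℍ))) '' (Γ : Set (ℍ ≃ᵢ ℍ)))
  cocompact : ∃ K : Set ℍ, IsCompact K ∧ ⋃ γ ∈ Γ, (γ : ℍ → ℍ) '' K = Set.univ

/-- A locally finite collection of geodesic lines whose complementary regions (the connected
components of the complement of the union) are bounded. -/
structure IsLineConfiguration (𝓛 : Set (Set ℍ)) : Prop where
  geodesic : ∀ L ∈ 𝓛, IsGeodesicLine L
  locallyFinite : LocallyFinite (fun L : 𝓛 => (L : Set ℍ))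
  bounded : ∀ x ∈ (⋃₀ 𝓛)ᶜ, Bornology.IsBounded (connectedComponentIn (⋃₀ 𝓛)ᶜ x)

/-- The subgroup `Γ` of isometries stabilizes the collection `𝓛`. -/
def Stabilizes (Γ : Subgroup (ℍ ≃ᵢ ℍ)) (𝓛 : Set (Set ℍ)) : Prop :=
  ∀ γ ∈ Γ, (fun L : Set ℍ => γ '' L) '' 𝓛 = 𝓛

/-- The collection of endpoint pairs of the members of `𝓛`. -/
def idealPairs (𝓛 : Set (Set ℍ)) : Set (Set Boundary) := ideal '' 𝓛

/-- The group of homeomorphisms of the boundary circle which preserve a collection `P` of subsets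
of the circle. -/
def homeoStab (P : Set (Set Boundary)) : Subgroup (Boundary ≃ₜ Boundary) where
  carrier := {g | (fun p : Set Boundary => g '' p) '' P = P}
  one_mem' := by
    have h : ∀ x, (1 : Boundary ≃ₜ Boundary) x = x := fun _ => rfl
    simp [h]
  mul_mem' := by
    intro a b ha hb
    simp only [Set.mem_ofPred_eq] at ha hb ⊢
    conv_rhs => rw [← ha, ← hb]
    simp only [Set.image_image]
    rfl
  inv_mem' := by
    intro a ha
    simp only [Set.mem_ofPred_eq] at ha ⊢
    conv_lhs => rw [← ha]
    simp only [Set.image_image]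
    have h : ∀ x, a⁻¹ (a x) = x := a.symm_apply_apply
    simp [h]

end HypPlane

/-!
The boundary circle of the upper half-plane is `OnePoint ℝ`, and everything reduces to the set
`idealPairs 𝓛` of endpoint pairs. Two lines are distinct and intersect exactly if their endpoint
pairs interlace (`linked_ideal_iff`). This relation (`Linked`) is expressed by connected subsets of
the circle, so it is preserved by all homeomorphisms. The geometry of the line configuration enters
through three facts, collected in `IsPairSystem`. Only finitely many pairs meet both of two disjoint
closed sets, because the corresponding lines meet a compact set. Every geodesic is crossed by a line
of the configuration, because otherwise a small push-off of it would be an unbounded connected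
subset of the complement (`IsLineConfiguration.exists_inter`). The relation is symmetric.

Rigidity (`IsPairSystem.eq_one_of_fixed`). Let `g` preserve a pair system and fix two linked pairs
`p₁`, `p₂` pointwise. Move `p₁` to `{0, ∞}`. Then `g` is an increasing map of the real line fixing
a positive and a negative endpoint. The endpoints of the pairs linked with `p₁` accumulate only at
`0` and `∞`, and an increasing bijection of a discrete subset of a ray which fixes one point
fixes all of them. So `g` fixes every pair linked with `p₁`, and inductively every pair which is
reached from `p₁` by a chain of linked pairs. The endpoints of these are dense
(`IsPairSystem.dense_linkComponent`): otherwise some geodesic would cut off a gap, and a line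
crossing this geodesic would separate the members of the chain component from each other. Hence
`g = 1`.

Boundary maps. Isometries of the upper half-plane are given by `GL(2, ℝ)`
(`exists_smul_eq_isometry`), which acts continuously on the Riemann sphere; this gives the extension
to the boundary and its uniqueness.

Finite index (`finiteIndex_boundaryGroup`). By rigidity, an element of the stabilizer is determined
by its values on the endpoints of two fixed intersecting lines. The images of the lines intersect
again, and the lattice can move the intersection point into a fixed compact set, which only finitely
many lines meet. So there are finitely many cosets.
-/

namespace HypPlane

open scoped OnePoint MatrixGroups

open Set

/-! ### Linked pairs of points -/

section Linked

variable {X Y : Type*} [TopologicalSpace X] [TopologicalSpace Y]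

/-- `p` separates `q`: the two sets are disjoint and every connected set containing `q` meets `p`.
For two pairs of points of a circle this says that they interlace. -/
def Linked (p q : Set X) : Prop :=
  Disjoint p q ∧ ∀ S, IsPreconnected S → q ⊆ S → (p ∩ S).Nonempty

lemma Linked.image {p q : Set X} (h : Linked p q) (e : X ≃ₜ Y) : Linked (e '' p) (e '' q) := by
  refine ⟨(disjoint_image_iff e.injective).2 h.1, fun S hS hq => ?_⟩
  obtain ⟨x, hx, hxS⟩ := h.2 (e ⁻¹' S) (e.isPreconnected_preimage.2 hS) (image_subset_iff.1 hq)
  exact ⟨e x, mem_image_of_mem _ hx, hxS⟩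

lemma linked_image_iff (e : X ≃ₜ Y) {p q : Set X} : Linked (e '' p) (e '' q) ↔ Linked p q := by
  refine ⟨fun h => ?_, fun h => h.image e⟩
  simpa [image_image] using h.image e.symm

lemma linked_pair_iff {p I E : Set X} (hI : IsOpen I) (hE : IsOpen E) (hIc : IsPreconnected I)
    (hEc : IsPreconnected E) (hd : Disjoint I E) (hcov : pᶜ = I ∪ E) (x y : X) :
    Linked p {x, y} ↔ (x ∈ I ∧ y ∈ E) ∨ (x ∈ E ∧ y ∈ I) := by
  have hp : ∀ z, z ∈ p ↔ ¬ (z ∈ I ∨ z ∈ E) := fun z => by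
    rw [← mem_union, ← hcov, mem_compl_iff, not_not]
  constructor
  · rintro ⟨h1, h2⟩
    have hx : x ∈ I ∨ x ∈ E := by
      by_contra h
      exact disjoint_left.1 h1 ((hp x).2 h) (by simp)
    have hy : y ∈ I ∨ y ∈ E := by
      by_contra h
      exact disjoint_left.1 h1 ((hp y).2 h) (by simp)
    rcases hx with hx | hx <;> rcases hy with hy | hy
    · obtain ⟨z, hz, hz'⟩ := h2 I hIc (by simp [insert_subset_iff, hx, hy])
      exact absurd (Or.inl hz') ((hp z).1 hz)
    · exact Or.inl ⟨hx, hy⟩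
    · exact Or.inr ⟨hx, hy⟩
    · obtain ⟨z, hz, hz'⟩ := h2 E hEc (by simp [insert_subset_iff, hx, hy])
      exact absurd (Or.inr hz') ((hp z).1 hz)
  · intro h
    constructor
    · rw [disjoint_left]
      rintro z hz (rfl | rfl)
      · exact (hp _).1 hz (by tauto)
      · exact (hp _).1 hz (by tauto)
    · intro S hS hxy
      have hxS : x ∈ S := hxy (by simp)
      have hyS : y ∈ S := hxy (by simp)
      by_contra hne
      have hcS : S ⊆ I ∪ E := fun z hz => by
        by_contra hz'
        exact hne ⟨z, (hp z).2 hz', hz⟩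
      have hne' : (S ∩ (I ∩ E)).Nonempty := by
        rcases h with ⟨h1, h2⟩ | ⟨h1, h2⟩
        · exact hS I E hI hE hcS ⟨x, hxS, h1⟩ ⟨y, hyS, h2⟩
        · exact hS I E hI hE hcS ⟨y, hyS, h2⟩ ⟨x, hxS, h1⟩
      obtain ⟨z, -, hz⟩ := hne'
      exact disjoint_left.1 hd hz.1 hz.2

lemma linked_zero_infty_iff (x y : Boundary) :
    Linked {((0 : ℝ) : Boundary), ∞} {x, y} ↔
      (x ∈ ((↑) : ℝ → Boundary) '' Ioi 0 ∧ y ∈ ((↑) : ℝ → Boundary) '' Iio 0) ∨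
      (x ∈ ((↑) : ℝ → Boundary) '' Iio 0 ∧ y ∈ ((↑) : ℝ → Boundary) '' Ioi 0) := by
  apply linked_pair_iff (OnePoint.isOpen_image_coe.2 isOpen_Ioi)
    (OnePoint.isOpen_image_coe.2 isOpen_Iio)
    (isPreconnected_Ioi.image _ OnePoint.continuous_coe.continuousOn)
    (isPreconnected_Iio.image _ OnePoint.continuous_coe.continuousOn)
  · rw [disjoint_image_iff OnePoint.coe_injective]
    exact disjoint_left.2 fun z hz hz' => lt_asymm (mem_Ioi.1 hz) (mem_Iio.1 hz')
  · ext z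
    induction z using OnePoint.rec with
    | infty => simp
    | coe z =>
      simp only [mem_compl_iff, mem_insert_iff, OnePoint.coe_eq_coe, mem_singleton_iff,
        OnePoint.coe_ne_infty, or_false, mem_union, mem_image, mem_Ioi, exists_eq_right, mem_Iio]
      constructor
      · intro h; exact (lt_or_gt_of_ne h).symm
      · rintro (h | h) <;> [exact h.ne'; exact h.ne]

lemma isPreconnected_compl_image_Icc (c d : ℝ) :
    IsPreconnected ((((↑) : ℝ → Boundary) '' Icc c d)ᶜ) := by
  have key : ∀ s : Set ℝ, IsPreconnected s → (∀ K, IsCompact K → (s \ K).Nonempty) →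
      IsPreconnected (((↑) : ℝ → Boundary) '' s ∪ {∞}) := fun s hs hK => by
    refine (hs.image _ OnePoint.continuous_coe.continuousOn).subset_closure
      subset_union_left (union_subset subset_closure ?_)
    rw [singleton_subset_iff, mem_closure_iff]
    intro o ho hoi
    obtain ⟨x, hx, hx'⟩ := hK _ ((OnePoint.isOpen_iff_of_mem hoi).1 ho).2
    exact ⟨x, not_not.1 hx', mem_image_of_mem _ hx⟩
  have h1 := key (Ioi d) isPreconnected_Ioi fun K hK => by
    obtain ⟨M, hM⟩ := hK.bddAbove
    refine ⟨max (M + 1) (d + 1), lt_of_lt_of_le (lt_add_one d) (le_max_right _ _), fun h => ?_⟩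
    have := (le_max_left _ _).trans (hM h)
    linarith
  have h2 := key (Iio c) isPreconnected_Iio fun K hK => by
    obtain ⟨M, hM⟩ := hK.bddBelow
    refine ⟨min (M - 1) (c - 1), lt_of_le_of_lt (min_le_right _ _) (sub_one_lt c), fun h => ?_⟩
    have := (hM h).trans (min_le_left _ _)
    linarith
  convert h1.union ∞ (by simp) (by simp) h2 using 1
  ext z
  induction z using OnePoint.rec with
  | infty => simp
  | coe z =>
    simp only [mem_compl_iff, mem_image, mem_Icc, OnePoint.coe_eq_coe, exists_eq_right, not_and,
      not_le, mem_union, mem_Ioi, mem_singleton_iff, OnePoint.coe_ne_infty, or_false, mem_Iio]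
    constructor
    · intro h
      by_cases hz : c ≤ z
      · exact Or.inl (h hz)
      · exact Or.inr (not_le.1 hz)
    · rintro (h | h) h'
      · exact h
      · exact absurd h' (not_le.2 h)

lemma linked_coe_coe_iff {c d : ℝ} (hcd : c < d) (x y : Boundary) :
    Linked {(c : Boundary), (d : Boundary)} {x, y} ↔
      (x ∈ ((↑) : ℝ → Boundary) '' Ioo c d ∧ y ∉ ((↑) : ℝ → Boundary) '' Icc c d) ∨
      (x ∉ ((↑) : ℝ → Boundary) '' Icc c d ∧ y ∈ ((↑) : ℝ → Boundary) '' Ioo c d) := by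
  apply linked_pair_iff (OnePoint.isOpen_image_coe.2 isOpen_Ioo)
    (isCompact_Icc.image OnePoint.continuous_coe).isClosed.isOpen_compl
    (isPreconnected_Ioo.image _ OnePoint.continuous_coe.continuousOn)
    (isPreconnected_compl_image_Icc c d)
  · rw [disjoint_compl_right_iff]
    exact image_mono Ioo_subset_Icc_self
  · ext z
    induction z using OnePoint.rec with
    | infty => simp
    | coe z =>
      simp only [mem_compl_iff, mem_insert_iff, OnePoint.coe_eq_coe, mem_singleton_iff,
        mem_union, mem_image, mem_Ioo, exists_eq_right, mem_Icc]
      grind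

/-! ### Systems of pairs on the circle -/

/-- The properties of the endpoint pairs of a line configuration which the rigidity argument uses.
They are invariant under homeomorphisms. -/
structure IsPairSystem (P : Set (Set X)) : Prop where
  pair : ∀ p ∈ P, ∃ a b, a ≠ b ∧ p = {a, b}
  finite : ∀ A B : Set X, IsClosed A → IsClosed B → Disjoint A B →
    {p ∈ P | (p ∩ A).Nonempty ∧ (p ∩ B).Nonempty}.Finite
  cross : ∀ a b, a ≠ b → ∃ q ∈ P, Linked {a, b} q
  symm : ∀ p ∈ P, ∀ q ∈ P, Linked p q → Linked q p

lemma IsPairSystem.image {P : Set (Set X)} (hP : IsPairSystem P) (e : X ≃ₜ Y) :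
    IsPairSystem ((fun p => e '' p) '' P) where
  pair := by
    rintro _ ⟨p, hp, rfl⟩
    obtain ⟨a, b, hab, rfl⟩ := hP.pair p hp
    exact ⟨e a, e b, e.injective.ne hab, image_pair _ _ _⟩
  finite A B hA hB hAB := by
    refine ((hP.finite (e ⁻¹' A) (e ⁻¹' B) (hA.preimage e.continuous) (hB.preimage e.continuous)
      (hAB.preimage e)).image (fun p => e '' p)).subset ?_
    rintro _ ⟨⟨p, hp, rfl⟩, ⟨x, ⟨y, hy, rfl⟩, hx⟩, ⟨x', ⟨y', hy', rfl⟩, hx'⟩⟩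
    exact ⟨p, ⟨hp, ⟨y, hy, hx⟩, ⟨y', hy', hx'⟩⟩, rfl⟩
  cross a b hab := by
    obtain ⟨q, hq, h⟩ := hP.cross (e.symm a) (e.symm b) (e.symm.injective.ne hab)
    refine ⟨e '' q, mem_image_of_mem _ hq, ?_⟩
    simpa [image_pair] using h.image e
  symm := by
    rintro _ ⟨p, hp, rfl⟩ _ ⟨q, hq, rfl⟩ h
    exact (hP.symm p hp q hq ((linked_image_iff e).1 h)).image e

end Linked

/-! ### Increasing maps preserving a locally finite set -/

/-- A strictly monotone self-map preserving a set cannot move a point of it towards a fixed point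
if there are only finitely many points of the set in between. -/
lemma le_map_of_finite_inter_Icc {α : Type*} [LinearOrder α] {f : α → α} (hf : StrictMono f)
    {U : Set α} (hU : MapsTo f U U) {u x : α} (hu : f u = u) (hux : u ≤ x) (hx : x ∈ U)
    (hfin : (U ∩ Icc u x).Finite) : x ≤ f x := by
  by_contra! h
  have hanti := hf.strictAnti_iterate_of_map_lt h
  refine (infinite_range_of_injective hanti.injective).mono ?_ hfin
  rintro _ ⟨n, rfl⟩
  refine ⟨hU.iterate n hx, ?_, ?_⟩
  · have := (hf.iterate n).monotone hux
    rwa [Function.iterate_fixed hu] at this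
  · simpa using hanti.antitone (Nat.zero_le n)

lemma map_eq_of_finite_inter_Icc {α : Type*} [LinearOrder α] {f f' : α → α} (hf : StrictMono f)
    (hf' : StrictMono f') (hff' : ∀ x, f (f' x) = x)
    {U : Set α} (hU : MapsTo f U U) (hU' : MapsTo f' U U) {u x : α} (hu : f u = u) (hux : u ≤ x)
    (hx : x ∈ U) (hfin : (U ∩ Icc u x).Finite) : f x = x := by
  refine le_antisymm ?_ (le_map_of_finite_inter_Icc hf hU hu hux hx hfin)
  have hu' : f' u = u := hf.injective (by rw [hff', hu])
  have := hf.monotone (le_map_of_finite_inter_Icc hf' hU' hu' hux hx hfin)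
  rwa [hff'] at this

lemma exists_real_of_map_infty {g : Boundary ≃ₜ Boundary} (hg : g ∞ = ∞) :
    ∃ f : ℝ → ℝ, ∀ x : ℝ, g x = f x := by
  have h : ∀ x : ℝ, ∃ y : ℝ, g x = y := fun x => by
    obtain ⟨y, hy⟩ := OnePoint.ne_infty_iff_exists.1
      (fun h => OnePoint.coe_ne_infty x (g.injective (h.trans hg.symm)))
    exact ⟨y, hy.symm⟩
  exact ⟨_, fun x => (h x).choose_spec⟩

lemma strictMono_of_fixed {g : Boundary ≃ₜ Boundary} {f : ℝ → ℝ} (hf : ∀ x : ℝ, g x = f x)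
    {a b : ℝ} (hab : a < b) (ha : g a = a) (hb : g b = b) : StrictMono f := by
  have hc : Continuous f := by
    rw [OnePoint.isOpenEmbedding_coe.isInducing.continuous_iff]
    exact (g.continuous.comp OnePoint.continuous_coe).congr hf
  have hi : Function.Injective f := fun x y h => by
    have : g x = g y := by rw [hf, hf, h]
    exact OnePoint.coe_injective (g.injective this)
  refine (hc.strictMono_of_inj hi).resolve_right fun h => ?_
  have ha' : f a = a := OnePoint.coe_injective ((hf a).symm.trans ha)
  have hb' : f b = b := OnePoint.coe_injective ((hf b).symm.trans hb)
  have := h hab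
  rw [ha', hb'] at this
  exact lt_asymm hab this

/-! ### Möbius transformations of the boundary and of the Riemann sphere -/

@[simp] lemma onePointCongr_coe {X Y : Type*} [TopologicalSpace X] [TopologicalSpace Y]
    (e : X ≃ₜ Y) (x : X) : e.onePointCongr (x : OnePoint X) = (e x : OnePoint Y) := rfl

section Continuity

variable {K : Type*} [NontriviallyNormedField K] [DecidableEq K]

lemma continuous_smul_onePoint_of_upper {g : GL (Fin 2) K} (hg : g 1 0 = 0) :
    Continuous (fun x : OnePoint K => g • x) := by
  have hdet := g.det_ne_zero
  rw [Matrix.det_fin_two, hg, mul_zero, sub_zero] at hdet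
  have ha : g 0 0 ≠ 0 := left_ne_zero_of_mul hdet
  have hd : g 1 1 ≠ 0 := right_ne_zero_of_mul hdet
  let e : K ≃ₜ K := (Homeomorph.mulLeft₀ (g 0 0 / g 1 1) (div_ne_zero ha hd)).trans
    (Homeomorph.addRight (g 0 1 / g 1 1))
  convert (e.onePointCongr).continuous using 1
  ext x
  induction x using OnePoint.rec with
  | infty => simp [OnePoint.smul_infty_eq_ite, hg]
  | coe x =>
    simp only [OnePoint.smul_some_eq_ite, hg, onePointCongr_coe, e]
    simp [hd]
    ring

/-- The matrix of `z ↦ 1 / z`. -/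
def swapGL (K : Type*) [Field K] : GL (Fin 2) K := .mkOfDetNeZero !![0, 1; 1, 0] (by simp)

variable [ProperSpace K]

lemma continuous_swapGL_smul : Continuous (fun x : OnePoint K => swapGL K • x) := by
  have hcoe : ∀ x : K, x ≠ 0 → swapGL K • (x : OnePoint K) = ((x⁻¹ : K) : OnePoint K) :=
      fun x hx => by
    simp [OnePoint.smul_some_eq_ite, swapGL, hx]
  have hzero : swapGL K • ((0 : K) : OnePoint K) = ∞ := by
    simp [OnePoint.smul_some_eq_ite, swapGL]
  have hinf : swapGL K • (∞ : OnePoint K) = ((0 : K) : OnePoint K) := by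
    simp [OnePoint.smul_infty_eq_ite, swapGL]
  rw [continuous_iff_continuousAt]
  intro x
  induction x using OnePoint.rec with
  | infty =>
    rw [OnePoint.continuousAt_infty', hinf, coclosedCompact_eq_cocompact,
      ← Metric.cobounded_eq_cocompact]
    have h : Tendsto (fun x : K => ((x⁻¹ : K) : OnePoint K)) (Bornology.cobounded K)
        (𝓝 ((0 : K) : OnePoint K)) :=
      (OnePoint.continuous_coe.tendsto 0).comp tendsto_inv₀_cobounded
    refine h.congr' ?_
    filter_upwards [Bornology.isBounded_singleton (x := (0 : K))] with x hx
    exact (hcoe x hx).symm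
  | coe x =>
    rw [OnePoint.continuousAt_coe]
    by_cases hx : x = 0
    · subst hx
      rw [continuousAt_iff_punctured_nhds]
      simp only [Function.comp, hzero]
      have h : Tendsto (fun x : K => ((x⁻¹ : K) : OnePoint K)) (𝓝[≠] 0) (𝓝 ∞) := by
        refine OnePoint.tendsto_coe_infty.comp ?_
        rw [coclosedCompact_eq_cocompact, ← Metric.cobounded_eq_cocompact]
        exact tendsto_inv₀_nhdsNE_zero
      refine h.congr' ?_
      filter_upwards [self_mem_nhdsWithin] with x hx
      exact (hcoe x hx).symm
    · have h : ContinuousAt (fun x : K => ((x⁻¹ : K) : OnePoint K)) x :=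
        OnePoint.continuous_coe.continuousAt.comp (continuousAt_inv₀ hx)
      refine h.congr ?_
      filter_upwards [isOpen_ne.mem_nhds hx] with y hy
      exact (hcoe y hy).symm

/-- A matrix which is not upper triangular is the product of an upper triangular matrix,
`z ↦ 1 / z` and an upper triangular matrix. -/
instance : ContinuousConstSMul (GL (Fin 2) K) (OnePoint K) where
  continuous_const_smul g := by
    by_cases hc : g 1 0 = 0
    · exact continuous_smul_onePoint_of_upper hc
    · have hdet := g.det_ne_zero
      rw [Matrix.det_fin_two] at hdet
      let u : GL (Fin 2) K := .mkOfDetNeZero !![g 0 1 - g 0 0 * g 1 1 / g 1 0, g 0 0 / g 1 0; 0, 1]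
        (by
          simp only [Matrix.det_fin_two_of, mul_one, mul_zero, sub_zero]
          intro h
          apply hdet
          field_simp at h
          linear_combination -h)
      let v : GL (Fin 2) K := .mkOfDetNeZero !![g 1 0, g 1 1; 0, 1] (by simpa using hc)
      have hg : g = u * (swapGL K * v) := by
        ext i j
        fin_cases i <;> fin_cases j <;>
          simp [u, v, swapGL, Matrix.mul_apply, Fin.sum_univ_two]
        all_goals field_simp
        all_goals ring
      have : (fun x : OnePoint K => g • x) = fun x => u • swapGL K • v • x := by
        ext x
        rw [smul_smul, smul_smul, mul_assoc, ← hg]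
      rw [this]
      exact (continuous_smul_onePoint_of_upper (by simp [u])).comp
        (continuous_swapGL_smul.comp (continuous_smul_onePoint_of_upper (by simp [v])))

end Continuity

/-- The boundary homeomorphism of an element of `GL(2, ℝ)`. -/
noncomputable def boundaryHomeo (g : GL (Fin 2) ℝ) : Boundary ≃ₜ Boundary := Homeomorph.smul g

/-- The homeomorphism of the Riemann sphere which extends the action of `g` on the upper
half-plane. It is antiholomorphic if `det g < 0`. -/
noncomputable def sphereHomeo (g : GL (Fin 2) ℝ) : OnePoint ℂ ≃ₜ OnePoint ℂ :=
  (Homeomorph.smul (g.map Complex.ofRealHom)).trans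
    (Homeomorph.onePointCongr (σ g).toHomeomorph)

lemma sphereHomeo_toSphere (g : GL (Fin 2) ℝ) (z : ℍ) :
    sphereHomeo g (toSphere z) = toSphere (g • z) := by
  have h := denom_ne_zero g z
  simp only [denom] at h
  simp [sphereHomeo, toSphere, OnePoint.smul_some_eq_ite, h,
    UpperHalfPlane.coe_smul, num, denom]

lemma sphereHomeo_boundaryToSphere (g : GL (Fin 2) ℝ) (ξ : Boundary) :
    sphereHomeo g (boundaryToSphere ξ) = boundaryToSphere (g • ξ) := by
  have h : ∀ η : Boundary, (σ g).toHomeomorph.onePointCongr (boundaryToSphere η) =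
      boundaryToSphere η := fun η => by
    induction η using OnePoint.rec with
    | infty => rfl
    | coe x => simp [boundaryToSphere]
  rw [← h (g • ξ)]
  exact congrArg (σ g).toHomeomorph.onePointCongr (OnePoint.map_smul Complex.ofRealHom g ξ).symm

lemma boundaryToSphere_injective : Function.Injective boundaryToSphere :=
  Option.map_injective Complex.ofReal_injective

lemma ideal_smul (g : GL (Fin 2) ℝ) (A : Set ℍ) :
    ideal ((fun z => g • z) '' A) = (fun ξ => g • ξ) '' ideal A := by
  have key : toSphere '' ((fun z => g • z) '' A) = sphereHomeo g '' (toSphere '' A) := by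
    simp only [image_image, sphereHomeo_toSphere]
  ext ξ
  rw [ideal, mem_ofPred_eq, key, ← Homeomorph.image_closure]
  have : boundaryToSphere ξ = sphereHomeo g (boundaryToSphere (g⁻¹ • ξ)) := by
    rw [sphereHomeo_boundaryToSphere, smul_inv_smul]
  rw [this, (sphereHomeo g).injective.mem_set_image]
  constructor
  · intro h
    exact ⟨g⁻¹ • ξ, h, smul_inv_smul _ _⟩
  · rintro ⟨η, hη, rfl⟩
    simpa using! hη

/-- A Möbius transformation which maps two given distinct points to `0` and `∞`. -/
lemma exists_smul_eq_zero_infty {a b : Boundary} (hab : a ≠ b) :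
    ∃ g : GL (Fin 2) ℝ, g • a = ((0 : ℝ) : Boundary) ∧ g • b = ∞ := by
  induction b using OnePoint.rec with
  | infty =>
    lift a to ℝ using hab
    exact ⟨.mkOfDetNeZero !![1, -a; 0, 1] (by simp), by simp [OnePoint.smul_some_eq_ite],
      by simp [OnePoint.smul_infty_eq_ite]⟩
  | coe b =>
    induction a using OnePoint.rec with
    | infty =>
      exact ⟨.mkOfDetNeZero !![0, 1; 1, -b] (by simp), by simp [OnePoint.smul_infty_eq_ite],
        by simp [OnePoint.smul_some_eq_ite]⟩
    | coe a =>
      have hab' : a - b ≠ 0 := sub_ne_zero.2 fun h => hab (by rw [h])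
      refine ⟨.mkOfDetNeZero !![1, -a; 1, -b] (by
        rw [Matrix.det_fin_two_of]
        contrapose! hab'
        linear_combination hab'), ?_, ?_⟩
      · have : a + -b ≠ 0 := by rwa [← sub_eq_add_neg]
        simp [OnePoint.smul_some_eq_ite, this]
      · simp [OnePoint.smul_some_eq_ite]

/-! ### Rigidity of pair systems -/

/-- In the normalization where the pair is `{0, ∞}`, the homeomorphism acts on the real line by an
increasing map, and the endpoints of the linked pairs accumulate only at `0` and `∞`. -/
lemma IsPairSystem.fixed_of_linked_zero_infty {P : Set (Set Boundary)} (hP : IsPairSystem P)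
    {g : Boundary ≃ₜ Boundary} (hg : (fun p : Set Boundary => g '' p) '' P = P)
    (h0 : g ((0 : ℝ) : Boundary) = ((0 : ℝ) : Boundary)) (hinf : g ∞ = ∞)
    {q : Set Boundary} (hq : q ∈ P) (hl : Linked {((0 : ℝ) : Boundary), ∞} q)
    (hfix : ∀ x ∈ q, g x = x) {p : Set Boundary} (hp : p ∈ P)
    (hlp : Linked {((0 : ℝ) : Boundary), ∞} p) {x : Boundary} (hx : x ∈ p) : g x = x := by
  -- every pair linked with `{0, ∞}` has one positive and one negative member
  have hsplit : ∀ p ∈ P, Linked {((0 : ℝ) : Boundary), ∞} p →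
      ∃ a b : ℝ, 0 < a ∧ b < 0 ∧ p = {(a : Boundary), (b : Boundary)} := fun p hp hl => by
    obtain ⟨a, b, -, rfl⟩ := hP.pair p hp
    rcases (linked_zero_infty_iff a b).1 hl with
      ⟨⟨a, ha, rfl⟩, b, hb, rfl⟩ | ⟨⟨b, hb, rfl⟩, a, ha, rfl⟩
    · exact ⟨a, b, ha, hb, rfl⟩
    · exact ⟨a, b, ha, hb, pair_comm _ _⟩
  have hinf' : g.symm ∞ = ∞ := by rw [g.symm_apply_eq, hinf]
  have h0' : g.symm ((0 : ℝ) : Boundary) = ((0 : ℝ) : Boundary) := by rw [g.symm_apply_eq, h0]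
  obtain ⟨f, hf⟩ := exists_real_of_map_infty hinf
  obtain ⟨f', hf'⟩ := exists_real_of_map_infty hinf'
  obtain ⟨u, v, hu, hv, rfl⟩ := hsplit q hq hl
  have hgu : g u = u := hfix _ (by simp)
  have hgv : g v = v := hfix _ (by simp)
  have hmono := strictMono_of_fixed hf hu h0 hgu
  have hmono' := strictMono_of_fixed hf' hu h0' (by rw [g.symm_apply_eq, hgu])
  have hff' : ∀ x, f (f' x) = x := fun x => by
    apply OnePoint.coe_injective
    rw [← hf, ← hf', g.apply_symm_apply]
  -- the finite endpoints of the pairs linked with `{0, ∞}`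
  let U : Set ℝ := {x | ∃ p ∈ P, Linked {((0 : ℝ) : Boundary), ∞} p ∧ (x : Boundary) ∈ p}
  have hU : MapsTo f U U := by
    rintro y ⟨p, hp, hl, hy⟩
    refine ⟨g '' p, hg ▸ mem_image_of_mem _ hp, ?_, y, hy, hf y⟩
    simpa [image_pair, h0, hinf] using hl.image g
  have hU' : MapsTo f' U U := by
    rintro y ⟨p, hp, hl, hy⟩
    obtain ⟨p, hp', rfl⟩ : p ∈ (fun p : Set Boundary => g '' p) '' P := hg.symm ▸ hp
    refine ⟨p, hp', ?_, ?_⟩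
    · simpa [image_pair, h0', hinf', image_image] using hl.image g.symm
    · obtain ⟨z, hz, hz'⟩ := hy
      rwa [← hf', ← hz', g.symm_apply_apply]
  have hfin : ∀ A B : Set Boundary, IsClosed A → IsClosed B → Disjoint A B →
      (∀ p ∈ P, Linked {((0 : ℝ) : Boundary), ∞} p → (p ∩ B).Nonempty) →
      (U ∩ (↑) ⁻¹' A).Finite := fun A B hA hB hAB hPB => by
    refine ((hP.finite A B hA hB hAB).biUnion
      (t := fun p => ((↑) : ℝ → Boundary) ⁻¹' p) ?_).subset ?_
    · rintro p ⟨hp, -⟩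
      obtain ⟨a, b, -, rfl⟩ := hP.pair p hp
      exact (toFinite {a, b}).preimage OnePoint.coe_injective.injOn
    · rintro y ⟨⟨p, hp, hl, hy⟩, hyA⟩
      exact mem_biUnion (show p ∈ {p ∈ P | _} from ⟨hp, ⟨_, hy, hyA⟩, hPB p hp hl⟩) hy
  have hIcc : ∀ a b : ℝ, IsClosed (((↑) : ℝ → Boundary) '' Icc a b) := fun a b =>
    (isCompact_Icc.image OnePoint.continuous_coe).isClosed
  have hpre : ∀ a b : ℝ, ((↑) : ℝ → Boundary) ⁻¹' (((↑) : ℝ → Boundary) '' Icc a b) = Icc a b :=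
    fun a b => preimage_image_eq _ OnePoint.coe_injective
  have hfinpos : ∀ a b : ℝ, 0 < a → (U ∩ Icc a b).Finite := fun a b ha => by
    rw [← hpre]
    refine hfin _ (((↑) : ℝ → Boundary) '' Ioi 0)ᶜ (hIcc _ _)
      (OnePoint.isOpen_image_coe.2 isOpen_Ioi).isClosed_compl ?_ ?_
    · rw [disjoint_compl_right_iff]
      exact image_mono fun z hz => ha.trans_le hz.1
    · intro p hp hl
      obtain ⟨c, d, hc, hd, rfl⟩ := hsplit p hp hl
      exact ⟨d, by simp, by simp [hd.le]⟩
  have hfinneg : ∀ a b : ℝ, b < 0 → (U ∩ Icc a b).Finite := fun a b hb => by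
    rw [← hpre]
    refine hfin _ (((↑) : ℝ → Boundary) '' Iio 0)ᶜ (hIcc _ _)
      (OnePoint.isOpen_image_coe.2 isOpen_Iio).isClosed_compl ?_ ?_
    · rw [disjoint_compl_right_iff]
      exact image_mono fun z hz => hz.2.trans_lt hb
    · intro p hp hl
      obtain ⟨c, d, hc, hd, rfl⟩ := hsplit p hp hl
      exact ⟨c, by simp, by simp [hc.le]⟩
  have hfu : f u = u := OnePoint.coe_injective ((hf u).symm.trans hgu)
  have hfv : f v = v := OnePoint.coe_injective ((hf v).symm.trans hgv)
  -- the restriction of `f` to either ray is treated by comparison with a fixed endpoint on it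
  have main : ∀ w : ℝ, f w = w → ∀ y ∈ U, (U ∩ Icc (min w y) (max w y)).Finite → f y = y := by
    intro w hw y hy hF
    rcases le_total w y with h | h
    · rw [min_eq_left h, max_eq_right h] at hF
      exact map_eq_of_finite_inter_Icc hmono hmono' hff' hU hU' hw h hy hF
    · rw [min_eq_right h, max_eq_left h] at hF
      refine map_eq_of_finite_inter_Icc (α := ℝᵒᵈ) (f := f) (f' := f') (U := U) (u := w) (x := y)
        hmono.dual hmono'.dual hff' hU hU' hw h hy ?_
      refine hF.subset fun z hz => ⟨hz.1, hz.2.2, hz.2.1⟩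
  obtain ⟨a, b, ha, hb, rfl⟩ := hsplit p hp hlp
  rcases hx with rfl | rfl
  · rw [hf, main u hfu a ⟨_, hp, hlp, by simp⟩ (hfinpos _ _ (lt_min hu ha))]
  · rw [hf, main v hfv b ⟨_, hp, hlp, by simp⟩ (hfinneg _ _ (max_lt hv hb))]

/-- A homeomorphism which preserves a pair system and fixes two linked pairs pointwise also fixes
pointwise every pair linked with the first one. -/
lemma IsPairSystem.fixed_of_linked {P : Set (Set Boundary)} (hP : IsPairSystem P)
    {g : Boundary ≃ₜ Boundary} (hg : (fun p : Set Boundary => g '' p) '' P = P)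
    {p₁ p₂ p : Set Boundary} (hp₁ : p₁ ∈ P) (hp₂ : p₂ ∈ P) (hl : Linked p₁ p₂)
    (hfix₁ : ∀ x ∈ p₁, g x = x) (hfix₂ : ∀ x ∈ p₂, g x = x) (hp : p ∈ P) (hlp : Linked p₁ p)
    {x : Boundary} (hx : x ∈ p) : g x = x := by
  obtain ⟨a, b, hab, rfl⟩ := hP.pair p₁ hp₁
  obtain ⟨m, ha, hb⟩ := exists_smul_eq_zero_infty hab
  let e := boundaryHomeo m
  have hea : e a = ((0 : ℝ) : Boundary) := ha
  have heb : e b = ∞ := hb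
  have hpair : e '' {a, b} = {((0 : ℝ) : Boundary), ∞} := by rw [image_pair, hea, heb]
  let g' : Boundary ≃ₜ Boundary := (e.symm.trans g).trans e
  have hg'e : ∀ y, g' (e y) = e (g y) := fun y => by simp [g']
  have hfix : ∀ q : Set Boundary, (∀ y ∈ q, g y = y) → ∀ y ∈ e '' q, g' y = y := by
    rintro q hq _ ⟨y, hy, rfl⟩
    rw [hg'e, hq y hy]
  have hfix' := hfix _ hfix₁
  rw [hpair] at hfix'
  have hg' : (fun p : Set Boundary => g' '' p) '' ((fun p => e '' p) '' P) =
      (fun p => e '' p) '' P := by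
    conv_rhs => rw [← hg]
    simp only [image_image, hg'e]
  have := (hP.image e).fixed_of_linked_zero_infty hg' (hfix' _ (by simp)) (hfix' _ (by simp))
    (mem_image_of_mem _ hp₂) (hpair ▸ hl.image e) (hfix _ hfix₂) (mem_image_of_mem _ hp)
    (hpair ▸ hlp.image e) (mem_image_of_mem e hx)
  rw [hg'e] at this
  exact e.injective this

/-- The pairs which are reached from `p` by a chain of successively linked members of `P`. -/
def linkComponent {X : Type*} [TopologicalSpace X] (P : Set (Set X)) (p : Set X) : Set (Set X) :=
  {q | Relation.ReflTransGen (fun r s => s ∈ P ∧ Linked r s) p q}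

/-- If `∞` is not in the closure of the endpoints, let `s` and `t` be their minimum and maximum. A
pair linked with `{s, t}` is not in the component, so that no pair of the component is linked
with it; it has one endpoint `u` between `s` and `t` and the other one outside. Hence all pairs of
the component are on the same side of `u`, against the choice of `s` and `t`. -/
lemma IsPairSystem.infty_mem_closure {P : Set (Set Boundary)} (hP : IsPairSystem P)
    {p : Set Boundary} (hp : p ∈ P) : ∞ ∈ closure (⋃₀ linkComponent P p) := by
  by_contra hinf
  have hsubP : linkComponent P p ⊆ P := fun q hq => by
    induction hq with
    | refl => exact hp
    | tail _ h _ => exact h.1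
  obtain ⟨K, hK, hKeq⟩ : ∃ K : Set ℝ, IsCompact K ∧
      ((↑) : ℝ → Boundary) '' K = closure (⋃₀ linkComponent P p) := by
    refine ⟨(↑) ⁻¹' closure (⋃₀ linkComponent P p),
      ((OnePoint.isClosed_iff_of_notMem hinf).1 isClosed_closure).2, ?_⟩
    rw [image_preimage_eq_iff]
    intro x hx
    exact OnePoint.ne_infty_iff_exists.1 fun h => hinf (h ▸ hx)
  -- the members of the component are pairs of real numbers
  have hpair : ∀ q ∈ linkComponent P p, ∃ c d : ℝ, c < d ∧ c ∈ K ∧ d ∈ K ∧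
      q = {(c : Boundary), (d : Boundary)} := fun q hq => by
    obtain ⟨a, b, hab, rfl⟩ := hP.pair q (hsubP hq)
    have ha : a ∈ ((↑) : ℝ → Boundary) '' K :=
      hKeq ▸ subset_closure (mem_sUnion_of_mem (by simp) hq)
    have hb : b ∈ ((↑) : ℝ → Boundary) '' K :=
      hKeq ▸ subset_closure (mem_sUnion_of_mem (by simp) hq)
    obtain ⟨c, hc, rfl⟩ := ha
    obtain ⟨d, hd, rfl⟩ := hb
    rcases lt_trichotomy c d with h | h | h
    · exact ⟨c, d, h, hc, hd, rfl⟩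
    · exact absurd (congrArg _ h) hab
    · exact ⟨d, c, h, hd, hc, pair_comm _ _⟩
  have hpp : p ∈ linkComponent P p := Relation.ReflTransGen.refl
  have hKne : K.Nonempty := by
    obtain ⟨c, -, -, hc, -⟩ := hpair p hpp
    exact ⟨c, hc⟩
  obtain ⟨s, hs⟩ := hK.exists_isLeast hKne
  obtain ⟨t, ht⟩ := hK.exists_isGreatest hKne
  have hst : s < t := by
    obtain ⟨c, d, hcd, hc, hd, -⟩ := hpair p hpp
    exact (hs.2 hc).trans_lt (hcd.trans_le (ht.2 hd))
  obtain ⟨q, hq, hlq⟩ := hP.cross (s : Boundary) (t : Boundary)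
    (fun h => hst.ne (OnePoint.coe_injective h))
  obtain ⟨u, v, hu, hv, rfl⟩ : ∃ (u : ℝ) (v : Boundary), u ∈ Ioo s t ∧
      v ∉ ((↑) : ℝ → Boundary) '' Icc s t ∧ q = {(u : Boundary), v} := by
    obtain ⟨a, b, -, rfl⟩ := hP.pair q hq
    rcases (linked_coe_coe_iff hst a b).1 hlq with ⟨⟨u, hu, rfl⟩, hv⟩ | ⟨hv, u, hu, rfl⟩
    · exact ⟨u, b, hu, hv, rfl⟩
    · exact ⟨u, a, hu, hv, pair_comm _ _⟩
  have hKst : K ⊆ Icc s t := fun z hz => ⟨hs.2 hz, ht.2 hz⟩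
  have hqn : {(u : Boundary), v} ∉ linkComponent P p := fun h => by
    apply hv
    have : v ∈ ((↑) : ℝ → Boundary) '' K :=
      hKeq ▸ subset_closure (mem_sUnion_of_mem (by simp) h)
    exact image_mono hKst this
  -- no member of the component is linked with `{u, v}`, so it lies on one side of `u`
  have hside : ∀ c d : ℝ, c < d → c ∈ K → d ∈ K →
      {(c : Boundary), (d : Boundary)} ∈ linkComponent P p → d ≤ u ∨ u ≤ c := by
    intro c d hcd hc hd hmem
    by_contra! h
    refine hqn (hmem.tail ⟨hq, (linked_coe_coe_iff hcd _ _).2 (Or.inl ⟨⟨u, ⟨h.2, h.1⟩, rfl⟩, ?_⟩)⟩)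
    exact fun hv' => hv (image_mono (Icc_subset_Icc (hs.2 hc) (ht.2 hd)) hv')
  -- linked members are on the same side
  have hstep : ∀ c d c' d' : ℝ, c < d → c' < d' →
      Linked {(c : Boundary), (d : Boundary)} {(c' : Boundary), (d' : Boundary)} →
      (d ≤ u → ¬ u ≤ c') ∧ (u ≤ c → ¬ d' ≤ u) := by
    intro c d c' d' h h' hl
    have := (linked_coe_coe_iff h _ _).1 hl
    simp only [mem_image, OnePoint.coe_eq_coe, exists_eq_right, mem_Ioo, mem_Icc] at this
    constructor <;> intro h1 h2 <;> grind
  have hall : (∀ q ∈ linkComponent P p, ∀ x : ℝ, (x : Boundary) ∈ q → x ≤ u) ∨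
      (∀ q ∈ linkComponent P p, ∀ x : ℝ, (x : Boundary) ∈ q → u ≤ x) := by
    obtain ⟨c, d, hcd, hc, hd, hpe⟩ := hpair p hpp
    rcases hside c d hcd hc hd (hpe ▸ hpp) with hcase | hcase
    · left
      suffices ∀ q ∈ linkComponent P p, ∃ c d : ℝ, c < d ∧ d ≤ u ∧
          q = {(c : Boundary), (d : Boundary)} by
        intro q hq x hx
        obtain ⟨c, d, hcd, hd, rfl⟩ := this q hq
        simp only [mem_insert_iff, OnePoint.coe_eq_coe, mem_singleton_iff] at hx
        grind
      intro q hq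
      induction hq with
      | refl => exact ⟨c, d, hcd, hcase, hpe⟩
      | tail hab hb ih =>
        obtain ⟨c, d, hcd, hd, rfl⟩ := ih
        have hmem := Relation.ReflTransGen.tail hab hb
        obtain ⟨c', d', hcd', hc', hd', rfl⟩ := hpair _ hmem
        exact ⟨c', d', hcd', (hside c' d' hcd' hc' hd' hmem).resolve_right
          ((hstep c d c' d' hcd hcd' hb.2).1 hd), rfl⟩
    · right
      suffices ∀ q ∈ linkComponent P p, ∃ c d : ℝ, c < d ∧ u ≤ c ∧
          q = {(c : Boundary), (d : Boundary)} by
        intro q hq x hx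
        obtain ⟨c, d, hcd, hd, rfl⟩ := this q hq
        simp only [mem_insert_iff, OnePoint.coe_eq_coe, mem_singleton_iff] at hx
        grind
      intro q hq
      induction hq with
      | refl => exact ⟨c, d, hcd, hcase, hpe⟩
      | tail hab hb ih =>
        obtain ⟨c, d, hcd, hd, rfl⟩ := ih
        have hmem := Relation.ReflTransGen.tail hab hb
        obtain ⟨c', d', hcd', hc', hd', rfl⟩ := hpair _ hmem
        exact ⟨c', d', hcd', (hside c' d' hcd' hc' hd' hmem).resolve_left
          ((hstep c d c' d' hcd hcd' hb.2).2 hd), rfl⟩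
  -- both alternatives pass to the closure, which contains `s` and `t`
  have hclos : ∀ F : Set ℝ, IsClosed F →
      (∀ q ∈ linkComponent P p, ∀ x : ℝ, (x : Boundary) ∈ q → x ∈ F) → K ⊆ F := by
    intro F hF h
    have h1 : closure (⋃₀ linkComponent P p) ⊆ (((↑) : ℝ → Boundary) '' Fᶜ)ᶜ := by
      refine closure_minimal ?_ (OnePoint.isOpen_image_coe.2 hF.isOpen_compl).isClosed_compl
      rintro x ⟨q, hq, hx⟩ ⟨y, hy, rfl⟩
      exact hy (h q hq y hx)
    intro x hx
    by_contra hxF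
    exact h1 (hKeq ▸ mem_image_of_mem _ hx) (mem_image_of_mem _ hxF)
  rcases hall with h | h
  · exact absurd (hclos (Iic u) isClosed_Iic h ht.1) (not_le.2 hu.2)
  · exact absurd (hclos (Ici u) isClosed_Ici h hs.1) (not_le.2 hu.1)

lemma IsPairSystem.dense_linkComponent {P : Set (Set Boundary)} (hP : IsPairSystem P)
    {p : Set Boundary} (hp : p ∈ P) : Dense (⋃₀ linkComponent P p) := by
  intro x
  obtain ⟨y, hy⟩ := exists_ne x
  obtain ⟨m, -, hm⟩ := exists_smul_eq_zero_infty hy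
  let e := boundaryHomeo m
  have hex : e x = ∞ := hm
  have h := (hP.image e).infty_mem_closure (mem_image_of_mem _ hp)
  rw [← hex, ← mem_preimage, e.preimage_closure] at h
  refine closure_mono ?_ h
  rintro z ⟨q, hq, hz⟩
  refine ⟨e.symm '' q, ?_, ⟨e z, hz, e.symm_apply_apply z⟩⟩
  have hlift : ∀ r s : Set Boundary, s ∈ (fun p => e '' p) '' P ∧ Linked r s →
      e.symm '' s ∈ P ∧ Linked (e.symm '' r) (e.symm '' s) := by
    rintro r _ ⟨⟨s, hs, rfl⟩, hl⟩
    exact ⟨by simpa [image_image] using hs, hl.image e.symm⟩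
  have := Relation.ReflTransGen.lift (p := fun r s => s ∈ P ∧ Linked r s) (fun q => e.symm '' q)
    hlift _ _ hq
  simpa [image_image, linkComponent, Function.onFun] using this

/-- Rigidity: a homeomorphism of the circle which preserves a pair system and fixes two linked
pairs pointwise is the identity. -/
theorem IsPairSystem.eq_one_of_fixed {P : Set (Set Boundary)} (hP : IsPairSystem P)
    {g : Boundary ≃ₜ Boundary} (hg : (fun p : Set Boundary => g '' p) '' P = P)
    {p₁ p₂ : Set Boundary} (hp₁ : p₁ ∈ P) (hp₂ : p₂ ∈ P) (hl : Linked p₁ p₂)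
    (hfix₁ : ∀ x ∈ p₁, g x = x) (hfix₂ : ∀ x ∈ p₂, g x = x) : g = 1 := by
  have key : ∀ q ∈ linkComponent P p₁, q ∈ P ∧ (∀ x ∈ q, g x = x) ∧
      ∃ r ∈ P, Linked q r ∧ ∀ x ∈ r, g x = x := fun q hq => by
    induction hq with
    | refl => exact ⟨hp₁, hfix₁, p₂, hp₂, hl, hfix₂⟩
    | tail hab hb ih =>
      obtain ⟨h1, h2, r, hr, hlr, hfr⟩ := ih
      exact ⟨hb.1, fun x hx => hP.fixed_of_linked hg h1 hr hlr h2 hfr hb.1 hb.2 hx, _, h1,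
        hP.symm _ h1 _ hb.1 hb.2, h2⟩
  have hclosed : IsClosed {x | g x = x} := isClosed_eq g.continuous continuous_id
  have hsub : ⋃₀ linkComponent P p₁ ⊆ {x | g x = x} := by
    rintro x ⟨q, hq, hx⟩
    exact (key q hq).2.1 x hx
  ext x
  exact closure_minimal hsub hclosed (hP.dense_linkComponent hp₁ x)

/-! ### Isometries and geodesic lines of the upper half-plane -/

lemma dist_eq_iff_cosh {z w z' w' : ℍ} :
    dist z w = dist z' w' ↔ Real.cosh (dist z w) = Real.cosh (dist z' w') :=
  (Real.cosh_injOn.eq_iff dist_nonneg dist_nonneg).symm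

lemma cosh_dist_re_im (z w : ℍ) : Real.cosh (dist z w) =
    1 + ((z.re - w.re) ^ 2 + (z.im - w.im) ^ 2) / (2 * z.im * w.im) := by
  rw [cosh_dist, Complex.dist_eq, ← Complex.normSq_eq_norm_sq, Complex.normSq_apply]
  simp [sq]

instance : IsIsometricSMul (GL (Fin 2) ℝ) ℍ where
  isometry_smul g := by
    refine Isometry.of_dist_eq fun z w => ?_
    rw [dist_eq_iff_cosh, cosh_dist, cosh_dist]
    have hz := denom_ne_zero g z
    have hw := denom_ne_zero g w
    have hdet : |g.det.val| ≠ 0 := abs_ne_zero.2 g.det.ne_zero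
    have hsub : num g z / denom g z - num g w / denom g w =
        (g.det.val : ℂ) * ((z : ℂ) - w) / (denom g z * denom g w) := by
      rw [div_sub_div _ _ hz hw]
      congr 1
      simp only [num, denom, Matrix.GeneralLinearGroup.val_det_apply, Matrix.det_fin_two]
      push_cast
      ring
    have hdist : dist ((g • z : ℍ) : ℂ) (g • w : ℍ) =
        |g.det.val| * dist (z : ℂ) w / (‖denom g z‖ * ‖denom g w‖) := by
      rw [UpperHalfPlane.coe_smul, UpperHalfPlane.coe_smul, Complex.dist_eq, ← map_sub, norm_σ,
        hsub, norm_div, norm_mul, norm_mul, Complex.norm_real, Real.norm_eq_abs, Complex.dist_eq]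
    rw [hdist, im_smul_eq_div_normSq, im_smul_eq_div_normSq, Complex.normSq_eq_norm_sq,
      Complex.normSq_eq_norm_sq]
    have h1 : ‖denom g z‖ ≠ 0 := norm_ne_zero_iff.2 hz
    have h2 : ‖denom g w‖ ≠ 0 := norm_ne_zero_iff.2 hw
    have := z.im_ne_zero
    have := w.im_ne_zero
    field_simp

/-- The imaginary half-axis. -/
def axis : Set ℍ := {z | z.re = 0}

/-- The parametrization of the imaginary half-axis by arc length. -/
noncomputable def axisPoint (t : ℝ) : ℍ := .mk ⟨0, Real.exp t⟩ (Real.exp_pos t)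

@[simp] lemma axisPoint_re (t : ℝ) : (axisPoint t).re = 0 := rfl

@[simp] lemma axisPoint_im (t : ℝ) : (axisPoint t).im = Real.exp t := rfl

lemma coe_axisPoint (t : ℝ) : (axisPoint t : ℂ) = Real.exp t * Complex.I := by
  apply Complex.ext <;> simp [axisPoint, Complex.exp_ofReal_re]

lemma isometry_axisPoint : Isometry axisPoint := isometry_vertical_line 0

lemma range_axisPoint : range axisPoint = axis := by
  ext z
  refine ⟨fun ⟨t, ht⟩ => ht ▸ axisPoint_re t, fun hz => ⟨Real.log z.im, ext_re_im ?_ ?_⟩⟩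
  · exact (axisPoint_re _).trans (Eq.symm hz)
  · rw [axisPoint_im, Real.exp_log z.im_pos]

/-- The distances from two points of the imaginary half-axis determine a point up to reflection in
the half-axis. -/
lemma im_eq_of_dist_axisPoint {z w : ℍ} (h0 : dist z (axisPoint 0) = dist w (axisPoint 0))
    (h1 : dist z (axisPoint 1) = dist w (axisPoint 1)) : z.im = w.im ∧ z.re ^ 2 = w.re ^ 2 := by
  rw [dist_eq_iff_cosh, cosh_dist_re_im, cosh_dist_re_im] at h0 h1
  simp only [axisPoint_re, axisPoint_im, Real.exp_zero, sub_zero] at h0 h1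
  have hz := z.im_pos
  have hw := w.im_pos
  have he : 1 < Real.exp 1 := Real.one_lt_exp_iff.2 one_pos
  set E := Real.exp 1
  rw [add_right_inj, div_eq_div_iff (by positivity) (by positivity)] at h0 h1
  have h0' : (z.re ^ 2 + z.im ^ 2 + 1) * w.im = (w.re ^ 2 + w.im ^ 2 + 1) * z.im := by
    linear_combination h0 / 2
  have h1' : (z.re ^ 2 + z.im ^ 2 + E ^ 2) * w.im = (w.re ^ 2 + w.im ^ 2 + E ^ 2) * z.im := by
    have hE : (2 * E) ≠ 0 := by positivity
    apply mul_left_cancel₀ hE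
    linear_combination h1
  -- the difference of the two equations determines the imaginary part
  have him : z.im = w.im := by
    have : (E ^ 2 - 1) * (w.im - z.im) = 0 := by linear_combination h1' - h0'
    rcases mul_eq_zero.1 this with h | h
    · nlinarith
    · linarith
  refine ⟨him, ?_⟩
  rw [him] at h0'
  have := mul_right_cancel₀ hw.ne' h0'
  linarith

lemma re_smul_eq (g : GL (Fin 2) ℝ) (z : ℍ) : (g • z).re =
    (g 0 0 * g 1 0 * (z.re ^ 2 + z.im ^ 2) + (g 0 0 * g 1 1 + g 0 1 * g 1 0) * z.re
      + g 0 1 * g 1 1) / Complex.normSq (denom g z) := by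
  rw [re_smul, Complex.div_re, ← add_div]
  congr 1
  simp [num, denom]
  ring

lemma re_smul_eq_zero_iff (g : GL (Fin 2) ℝ) (z : ℍ) : (g • z).re = 0 ↔
    g 0 0 * g 1 0 * (z.re ^ 2 + z.im ^ 2) + (g 0 0 * g 1 1 + g 0 1 * g 1 0) * z.re
      + g 0 1 * g 1 1 = 0 := by
  rw [re_smul_eq, div_eq_zero_iff, or_iff_left (normSq_denom_ne_zero g z.im_ne_zero)]

lemma normSq_denom_axisPoint (g : GL (Fin 2) ℝ) (t : ℝ) :
    Complex.normSq (denom g (axisPoint t)) = (g 1 0 * Real.exp t) ^ 2 + g 1 1 ^ 2 := by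
  simp [denom, coe_axisPoint, Complex.normSq_apply, Complex.exp_ofReal_re]
  ring

/-- Any two points are on a Möbius image of the imaginary half-axis. -/
lemma exists_smul_mem_axis (z w : ℍ) : ∃ g : GL (Fin 2) ℝ, g • z ∈ axis ∧ g • w ∈ axis := by
  by_cases h : z.re = w.re
  · refine ⟨.mkOfDetNeZero !![1, -z.re; 0, 1] (by simp), ?_, ?_⟩
    · simp [axis, re_smul_eq_zero_iff]
    · simp [axis, re_smul_eq_zero_iff, h]
  · -- the half-circle through `z` and `w` has centre `m` and radius `R`
    have h' : z.re - w.re ≠ 0 := sub_ne_zero.2 h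
    obtain ⟨m, hm⟩ : ∃ m : ℝ, 2 * m * (z.re - w.re) = z.re ^ 2 + z.im ^ 2 - w.re ^ 2 - w.im ^ 2 :=
      ⟨(z.re ^ 2 + z.im ^ 2 - w.re ^ 2 - w.im ^ 2) / (2 * (z.re - w.re)), by field_simp⟩
    have hpos : 0 < (z.re - m) ^ 2 + z.im ^ 2 := by have := z.im_pos; positivity
    obtain ⟨R, hR0, hR⟩ : ∃ R : ℝ, 0 < R ∧ R ^ 2 = (z.re - m) ^ 2 + z.im ^ 2 :=
      ⟨_, Real.sqrt_pos.2 hpos, Real.sq_sqrt hpos.le⟩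
    -- the matrix maps its endpoints `m - R` and `m + R` to `0` and `∞`
    refine ⟨.mkOfDetNeZero !![1, -(m - R); -1, m + R] ?_, ?_, ?_⟩
    · rw [Matrix.det_fin_two_of]
      linarith
    · simp only [axis, mem_ofPred_eq, re_smul_eq_zero_iff]
      simp
      linear_combination hR
    · simp only [axis, mem_ofPred_eq, re_smul_eq_zero_iff]
      simp
      linear_combination hR - hm

/-- The matrix of `z ↦ exp (-a) * z`. -/
noncomputable def scaleGL (a : ℝ) : GL (Fin 2) ℝ := .mkOfDetNeZero !![1, 0; 0, Real.exp a]
  (by simp)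

lemma scaleGL_smul_axisPoint (a t : ℝ) : scaleGL a • axisPoint t = axisPoint (t - a) := by
  refine ext_re_im ?_ ?_
  · rw [axisPoint_re, re_smul_eq_zero_iff]
    simp [scaleGL]
  · rw [im_smul_eq_div_normSq, normSq_denom_axisPoint]
    simp [scaleGL, Real.exp_sub, abs_of_pos (Real.exp_pos a)]
    field_simp

lemma swapGL_smul_axisPoint (t : ℝ) : swapGL ℝ • axisPoint t = axisPoint (-t) := by
  refine ext_re_im ?_ ?_
  · rw [axisPoint_re, re_smul_eq_zero_iff]
    simp [swapGL]
  · rw [im_smul_eq_div_normSq, normSq_denom_axisPoint]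
    simp [swapGL, Real.exp_neg]
    field_simp

lemma exists_smul_eq_axisPoint (z w : ℍ) :
    ∃ g : GL (Fin 2) ℝ, g • z = axisPoint 0 ∧ g • w = axisPoint (dist z w) := by
  obtain ⟨g, hz, hw⟩ := exists_smul_mem_axis z w
  rw [← range_axisPoint] at hz hw
  obtain ⟨a, ha⟩ := hz
  obtain ⟨b, hb⟩ := hw
  have hd : dist z w = |b - a| := by
    rw [← dist_smul g, ← ha, ← hb, isometry_axisPoint.dist_eq, dist_comm, Real.dist_eq]
  rcases le_total 0 (b - a) with h | h
  · refine ⟨scaleGL a * g, ?_, ?_⟩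
    · rw [mul_smul, ← ha, scaleGL_smul_axisPoint, sub_self]
    · rw [mul_smul, ← hb, scaleGL_smul_axisPoint, hd, abs_of_nonneg h]
  · refine ⟨swapGL ℝ * (scaleGL a * g), ?_, ?_⟩
    · rw [mul_smul, mul_smul, ← ha, scaleGL_smul_axisPoint, swapGL_smul_axisPoint, sub_self,
        neg_zero]
    · rw [mul_smul, mul_smul, ← hb, scaleGL_smul_axisPoint, swapGL_smul_axisPoint, hd,
        abs_of_nonpos h]

/-- Every isometric embedding of the line is a Möbius image of the imaginary half-axis. -/
lemma exists_smul_isometry_eq {c : ℝ → ℍ} (hc : Isometry c) :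
    ∃ g : GL (Fin 2) ℝ, ∀ t, g • c t = axisPoint t := by
  obtain ⟨g, h0, h1⟩ := exists_smul_eq_axisPoint (c 0) (c 1)
  rw [hc.dist_eq, Real.dist_eq] at h1
  norm_num at h1
  refine ⟨g, fun t => ?_⟩
  have hd : ∀ s, g • c s = axisPoint s → dist (g • c t) (axisPoint s) =
      dist (axisPoint t) (axisPoint s) := fun s hs => by
    rw [← hs, dist_smul, hc.dist_eq, hs, isometry_axisPoint.dist_eq]
  obtain ⟨him, hre⟩ := im_eq_of_dist_axisPoint (hd 0 h0) (hd 1 h1)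
  refine ext_re_im ?_ him
  simpa using hre

lemma isGeodesicLine_iff {L : Set ℍ} :
    IsGeodesicLine L ↔ ∃ g : GL (Fin 2) ℝ, L = (fun z => g • z) '' axis := by
  constructor
  · rintro ⟨c, hc, rfl⟩
    obtain ⟨g, hg⟩ := exists_smul_isometry_eq hc
    refine ⟨g⁻¹, ?_⟩
    rw [← range_axisPoint, ← range_comp]
    congr 1
    ext1 t
    rw [Function.comp_apply, ← hg, inv_smul_smul]
  · rintro ⟨g, rfl⟩
    refine ⟨fun t => g • axisPoint t, (isometry_smul ℍ g).comp isometry_axisPoint, ?_⟩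
    rw [← range_axisPoint, ← range_comp]
    rfl

/-- An isometry fixing three points which are not on a common line is the identity. -/
lemma eq_of_fixed {f : ℍ → ℍ} (hf : Isometry f) (h0 : f (axisPoint 0) = axisPoint 0)
    (h1 : f (axisPoint 1) = axisPoint 1) {w : ℍ} (hw : w.re ≠ 0) (hfw : f w = w) (z : ℍ) :
    f z = z := by
  have hd : ∀ s, f s = s → dist (f z) s = dist z s := fun s hs => by
    rw [← hf.dist_eq z s, hs]
  obtain ⟨him, hre⟩ := im_eq_of_dist_axisPoint (hd _ h0) (hd _ h1)
  refine ext_re_im ?_ him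
  have h := hd w hfw
  rw [dist_eq_iff_cosh, cosh_dist_re_im, cosh_dist_re_im, him, add_right_inj,
    div_left_inj' (by have := z.im_pos; have := w.im_pos; positivity)] at h
  apply mul_left_cancel₀ hw
  linear_combination hre / 2 - h / 2

lemma J_smul_re (z : ℍ) : (J • z).re = -z.re := by
  rw [← coe_re, coe_J_smul]
  simp

lemma J_smul_im (z : ℍ) : (J • z).im = z.im := by
  rw [← coe_im, coe_J_smul]
  simp

/-- Every isometry of the upper half-plane is given by an element of `GL(2, ℝ)`. -/
lemma exists_smul_eq_isometry (γ : ℍ ≃ᵢ ℍ) : ∃ g : GL (Fin 2) ℝ, ∀ z, γ z = g • z := by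
  obtain ⟨g, hg⟩ := exists_smul_isometry_eq (γ.isometry.comp isometry_axisPoint)
  simp only [Function.comp_apply] at hg
  have hJ : ∀ t, J • axisPoint t = axisPoint t := fun t =>
    ext_re_im (by rw [J_smul_re]; simp) (J_smul_im _)
  let w : ℍ := .mk ⟨1, 1⟩ one_pos
  have hwre : w.re = 1 := rfl
  have hw : w.re ≠ 0 := by rw [hwre]; exact one_ne_zero
  have hf : Isometry (fun z => g • γ z) := (isometry_smul ℍ g).comp γ.isometry
  have hd : ∀ t, dist (g • γ w) (axisPoint t) = dist w (axisPoint t) := fun t => by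
    rw [← hg t, dist_smul, γ.dist_eq]
    rw [hg]
  -- after composition with `g` the isometry fixes the half-axis pointwise, so that it maps `w`
  -- to itself or to its mirror image
  obtain ⟨him, hre⟩ := im_eq_of_dist_axisPoint (hd 0) (hd 1)
  rcases sq_eq_sq_iff_eq_or_eq_neg.1 hre with h | h
  · refine ⟨g⁻¹, fun z => ?_⟩
    rw [eq_inv_smul_iff]
    exact eq_of_fixed hf (hg 0) (hg 1) hw (ext_re_im h him) z
  · refine ⟨g⁻¹ * J⁻¹, fun z => ?_⟩
    rw [mul_smul, eq_inv_smul_iff, eq_inv_smul_iff]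
    refine eq_of_fixed (f := fun z => J • g • γ z) ((isometry_smul ℍ J).comp hf) ?_ ?_ hw ?_ z
    · rw [hg, hJ]
    · rw [hg, hJ]
    · exact ext_re_im (by rw [J_smul_re, h, neg_neg]) (by rw [J_smul_im, him])

/-! ### Endpoints of geodesic lines -/

lemma ideal_axis : ideal axis = {((0 : ℝ) : Boundary), ∞} := by
  have hmem : ∀ t, toSphere (axisPoint t) ∈ toSphere '' axis := fun t =>
    mem_image_of_mem _ (axisPoint_re t)
  ext ξ
  induction ξ using OnePoint.rec with
  | infty =>
    simp only [ideal, mem_ofPred_eq, mem_insert_iff, OnePoint.infty_ne_coe, mem_singleton_iff,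
      or_true, iff_true]
    refine mem_closure_of_tendsto (f := fun t => toSphere (axisPoint t)) (b := atTop) ?_
      (Eventually.of_forall hmem)
    refine OnePoint.tendsto_coe_infty.comp ?_
    rw [coclosedCompact_eq_cocompact, ← Metric.cobounded_eq_cocompact,
      ← tendsto_norm_atTop_iff_cobounded]
    refine Real.tendsto_exp_atTop.congr fun t => ?_
    rw [coe_axisPoint, norm_mul, Complex.norm_I, mul_one, Complex.norm_real, Real.norm_eq_abs,
      Real.abs_exp]
  | coe x =>
    simp only [ideal, mem_ofPred_eq, mem_insert_iff, OnePoint.coe_eq_coe, mem_singleton_iff,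
      OnePoint.coe_ne_infty, or_false]
    constructor
    · intro h
      have h' : (x : ℂ) ∈ closure (UpperHalfPlane.coe '' axis) := by
        rw [OnePoint.isOpenEmbedding_coe.isInducing.closure_eq_preimage_closure_image, image_image]
        exact h
      have hcl : IsClosed {z : ℂ | z.re = 0} := isClosed_eq Complex.continuous_re continuous_const
      refine closure_minimal ?_ hcl h'
      rintro _ ⟨z, hz, rfl⟩
      exact hz
    · rintro rfl
      refine mem_closure_of_tendsto (f := fun t => toSphere (axisPoint t)) (b := atBot) ?_
        (Eventually.of_forall hmem)
      refine (OnePoint.continuous_coe.tendsto _).comp ?_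
      have : Tendsto (fun t : ℝ => (Real.exp t : ℂ) * Complex.I) atBot
          (𝓝 (((0 : ℝ) : ℂ) * Complex.I)) :=
        ((Complex.continuous_ofReal.tendsto 0).comp Real.tendsto_exp_atBot).mul_const _
      simpa [coe_axisPoint] using this

lemma ideal_smul_axis (g : GL (Fin 2) ℝ) : ideal ((fun z => g • z) '' axis) =
    {g • ((0 : ℝ) : Boundary), g • (∞ : Boundary)} := by
  rw [ideal_smul, ideal_axis, image_pair]

/-- Diagonal and antidiagonal matrices preserve the imaginary half-axis. -/
lemma smul_axis_eq_of_zero (h : GL (Fin 2) ℝ)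
    (hh : (h 1 0 = 0 ∧ h 0 1 = 0) ∨ (h 0 0 = 0 ∧ h 1 1 = 0)) :
    (fun z => h • z) '' axis = axis := by
  have key : ∀ z : ℍ, h • z ∈ axis ↔ z ∈ axis := fun z => by
    have hdet := h.det_ne_zero
    rw [Matrix.det_fin_two] at hdet
    simp only [axis, mem_ofPred_eq, re_smul_eq_zero_iff]
    rcases hh with ⟨h1, h2⟩ | ⟨h1, h2⟩
    · simp only [h1, h2, mul_zero, sub_zero] at hdet
      simp [h1, h2, left_ne_zero_of_mul hdet, right_ne_zero_of_mul hdet]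
    · simp only [h1, h2, mul_zero, zero_sub, neg_ne_zero] at hdet
      simp [h1, h2, left_ne_zero_of_mul hdet, right_ne_zero_of_mul hdet]
  ext z
  constructor
  · rintro ⟨w, hw, rfl⟩
    exact (key w).2 hw
  · intro hz
    exact ⟨h⁻¹ • z, by rwa [← key, smul_inv_smul], smul_inv_smul _ _⟩

lemma smul_zero_eq_infty_iff {h : GL (Fin 2) ℝ} :
    h • ((0 : ℝ) : Boundary) = ∞ ↔ h 1 1 = 0 := by
  simp [OnePoint.smul_some_eq_ite]

lemma smul_axisPoint_mem_axis_iff (h : GL (Fin 2) ℝ) (t : ℝ) : h • axisPoint t ∈ axis ↔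
    h 0 0 * h 1 0 * Real.exp t ^ 2 + h 0 1 * h 1 1 = 0 := by
  simp [axis, re_smul_eq_zero_iff]

lemma linked_axis_iff (h : GL (Fin 2) ℝ) :
    Linked (ideal axis) (ideal ((fun z => h • z) '' axis)) ↔
      axis ≠ (fun z => h • z) '' axis ∧ (axis ∩ (fun z => h • z) '' axis).Nonempty := by
  have hdet := h.det_ne_zero
  rw [Matrix.det_fin_two] at hdet
  have hint : (axis ∩ (fun z => h • z) '' axis).Nonempty ↔
      ∃ t, h 0 0 * h 1 0 * Real.exp t ^ 2 + h 0 1 * h 1 1 = 0 := by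
    simp only [← smul_axisPoint_mem_axis_iff]
    constructor
    · rintro ⟨_, hz, w, hw, rfl⟩
      obtain ⟨t, rfl⟩ : w ∈ range axisPoint := range_axisPoint ▸ hw
      exact ⟨t, hz⟩
    · rintro ⟨t, ht⟩
      exact ⟨_, ht, _, axisPoint_re t, rfl⟩
  have hlink : Linked (ideal axis) (ideal ((fun z => h • z) '' axis)) ↔
      h 0 0 * h 1 0 * (h 0 1 * h 1 1) < 0 := by
    rw [ideal_smul_axis, ideal_axis, linked_zero_infty_iff, OnePoint.smul_some_eq_ite,
      OnePoint.smul_infty_eq_ite]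
    by_cases hc : h 1 0 = 0
    · simp [hc]
    by_cases hd : h 1 1 = 0
    · simp [hd]
    simp only [mul_zero, zero_add, hc, hd, if_false, mem_image, mem_Ioi, mem_Iio,
      OnePoint.coe_eq_coe, exists_eq_right]
    have hmul : h 0 1 / h 1 1 * (h 0 0 / h 1 0) * (h 1 0 * h 1 1) ^ 2 =
        h 0 0 * h 1 0 * (h 0 1 * h 1 1) := by
      field_simp
    have hpos : 0 < (h 1 0 * h 1 1) ^ 2 := by positivity
    have hiff : ∀ r s : ℝ, 0 < s → (r * s < 0 ↔ r < 0) := fun r s hs =>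
      ⟨fun hrs => by by_contra hr; nlinarith, fun hr => mul_neg_of_neg_of_pos hr hs⟩
    rw [← hmul, hiff _ _ hpos, mul_neg_iff]
  rw [hlink, hint]
  constructor
  · intro hneg
    refine ⟨fun heq => ?_, ?_⟩
    · have hl := hlink.2 hneg
      rw [← heq] at hl
      rw [ideal_axis] at hl
      exact disjoint_left.1 hl.1 (mem_insert _ _) (mem_insert _ _)
    · have hac : h 0 0 * h 1 0 ≠ 0 := left_ne_zero_of_mul hneg.ne
      have hr : 0 < -(h 0 1 * h 1 1) / (h 0 0 * h 1 0) := by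
        rw [neg_div, neg_pos, div_neg_iff]
        rcases mul_neg_iff.1 hneg with ⟨h1, h2⟩ | ⟨h1, h2⟩
        · exact Or.inr ⟨h2, h1⟩
        · exact Or.inl ⟨h2, h1⟩
      refine ⟨Real.log (Real.sqrt (-(h 0 1 * h 1 1) / (h 0 0 * h 1 0))), ?_⟩
      rw [Real.exp_log (Real.sqrt_pos.2 hr), Real.sq_sqrt hr.le, mul_div_cancel₀ _ hac,
        neg_add_cancel]
  · rintro ⟨hne, t, ht⟩
    have hE := Real.exp_pos t
    by_contra hneg
    have h1 : h 0 0 * h 1 0 = 0 := by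
      by_contra h1
      have : 0 < (h 0 0 * h 1 0) ^ 2 * Real.exp t ^ 2 := by positivity
      have h2 : h 0 1 * h 1 1 = -(h 0 0 * h 1 0 * Real.exp t ^ 2) := by linear_combination ht
      rw [h2] at hneg
      nlinarith
    have h2 : h 0 1 * h 1 1 = 0 := by rwa [h1, zero_mul, zero_add] at ht
    apply hne
    symm
    apply smul_axis_eq_of_zero
    rcases mul_eq_zero.1 h1 with h1 | h1 <;> rcases mul_eq_zero.1 h2 with h2 | h2
    · simp [h1, h2] at hdet
    · exact Or.inr ⟨h1, h2⟩
    · exact Or.inl ⟨h1, h2⟩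
    · simp [h1, h2] at hdet

/-- Two geodesic lines are distinct and intersect exactly if their endpoints interlace. -/
lemma linked_ideal_iff {L L' : Set ℍ} (hL : IsGeodesicLine L) (hL' : IsGeodesicLine L') :
    Linked (ideal L) (ideal L') ↔ L ≠ L' ∧ (L ∩ L').Nonempty := by
  obtain ⟨g, rfl⟩ := isGeodesicLine_iff.1 hL
  obtain ⟨g', rfl⟩ := isGeodesicLine_iff.1 hL'
  have h : (fun z : ℍ => g' • z) '' axis =
      (fun z => g • z) '' ((fun z => (g⁻¹ * g') • z) '' axis) := by
    simp [image_image, mul_smul]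
  have hinj : Function.Injective (fun z : ℍ => g • z) := MulAction.injective g
  rw [h, ideal_smul, ideal_smul]
  change Linked (boundaryHomeo g '' _) (boundaryHomeo g '' _) ↔ _
  rw [linked_image_iff, linked_axis_iff, ← image_inter hinj, image_nonempty,
    hinj.image_injective.ne_iff]

lemma exists_geodesicLine_ideal_eq {a b : Boundary} (hab : a ≠ b) :
    ∃ L, IsGeodesicLine L ∧ ideal L = {a, b} := by
  obtain ⟨g, ha, hb⟩ := exists_smul_eq_zero_infty hab
  refine ⟨_, isGeodesicLine_iff.2 ⟨g⁻¹, rfl⟩, ?_⟩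
  rw [ideal_smul_axis, ← ha, ← hb, inv_smul_smul, inv_smul_smul]

/-- A line with one endpoint near `0` and the other one near `∞` meets a fixed compact set. -/
lemma exists_smul_axisPoint_mem {h : GL (Fin 2) ℝ}
    (h0 : h • ((0 : ℝ) : Boundary) ∈ ((↑) : ℝ → Boundary) '' Ioo (-1 / 2) (1 / 2))
    (hinf : swapGL ℝ • h • (∞ : Boundary) ∈ ((↑) : ℝ → Boundary) '' Ioo (-1 / 2) (1 / 2)) :
    ∃ t, (h • axisPoint t).re ∈ Icc (-1) 1 ∧ (h • axisPoint t).im ∈ Icc (1 / 2) 2 := by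
  obtain ⟨u, hu, hu0⟩ := h0
  obtain ⟨w, hw, hw0⟩ := hinf
  have hd : h 1 1 ≠ 0 := fun hd => by
    rw [smul_zero_eq_infty_iff.2 hd] at hu0
    exact OnePoint.coe_ne_infty _ hu0
  have hb : h 0 1 = u * h 1 1 := by
    simp only [OnePoint.smul_some_eq_ite, mul_zero, zero_add, hd, if_false,
      OnePoint.coe_eq_coe] at hu0
    rw [hu0]
    field_simp
  have hw0' : (w : Boundary) =
      if h 0 0 = 0 then (∞ : Boundary) else ((h 1 0 / h 0 0 : ℝ) : Boundary) := by
    rw [hw0, smul_smul, OnePoint.smul_infty_eq_ite]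
    simp [swapGL, Matrix.mul_apply, Fin.sum_univ_two]
  have ha : h 0 0 ≠ 0 := fun ha => by
    rw [if_pos ha] at hw0'
    exact OnePoint.coe_ne_infty _ hw0'
  have hc : h 1 0 = w * h 0 0 := by
    rw [if_neg ha, OnePoint.coe_eq_coe] at hw0'
    rw [hw0']
    field_simp
  have hpos : 0 < |h 1 1| / |h 0 0| := by positivity
  have hw1 : 0 < 1 + w ^ 2 := by positivity
  -- this parameter normalizes the columns of `h`: the resulting point of the line with endpoints
  -- `u` and `1 / w` is `(w + u + i (1 - u * w)) / (1 + w ^ 2)`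
  refine ⟨Real.log (|h 1 1| / |h 0 0|), ?_⟩
  have hre : (h • axisPoint (Real.log (|h 1 1| / |h 0 0|))).re = (w + u) / (1 + w ^ 2) := by
    rw [re_smul_eq, normSq_denom_axisPoint, axisPoint_re, axisPoint_im, Real.exp_log hpos, hb, hc,
      mul_pow, div_pow, sq_abs, sq_abs]
    field_simp
    ring
  have him : (h • axisPoint (Real.log (|h 1 1| / |h 0 0|))).im = (1 - u * w) / (1 + w ^ 2) := by
    have hdet : h.det.val = h 0 0 * h 1 1 * (1 - u * w) := by
      rw [Matrix.GeneralLinearGroup.val_det_apply, Matrix.det_fin_two, hb, hc]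
      ring
    have huw : 0 < 1 - u * w := by nlinarith [hu.1, hu.2, hw.1, hw.2]
    rw [im_smul_eq_div_normSq, normSq_denom_axisPoint, axisPoint_im, Real.exp_log hpos, hdet, hc,
      abs_mul, abs_mul, abs_of_pos huw, mul_pow, div_pow, sq_abs, sq_abs]
    have h1 : |h 1 1| * |h 1 1| = h 1 1 ^ 2 := by rw [abs_mul_abs_self, sq]
    have h2 : |h 0 0| ≠ 0 := abs_ne_zero.2 ha
    field_simp
    linear_combination (1 + w ^ 2) * h1
  rw [hre, him]
  obtain ⟨hu1, hu2⟩ := hu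
  obtain ⟨hw1', hw2⟩ := hw
  refine ⟨⟨?_, ?_⟩, ?_, ?_⟩
  · rw [le_div_iff₀ hw1]; nlinarith
  · rw [div_le_iff₀ hw1]; nlinarith
  · rw [le_div_iff₀ hw1]; nlinarith
  · rw [div_le_iff₀ hw1]; nlinarith

lemma isCompact_re_im_Icc (a b : ℝ) {c d : ℝ} (hc : 0 < c) :
    IsCompact {z : ℍ | z.re ∈ Icc a b ∧ z.im ∈ Icc c d} := by
  rw [UpperHalfPlane.isEmbedding_coe.isCompact_iff]
  convert (isCompact_Icc (a := a) (b := b)).reProdIm (isCompact_Icc (a := c) (b := d)) using 1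
  ext z
  rw [Complex.mem_reProdIm]
  constructor
  · rintro ⟨w, hw, rfl⟩
    exact hw
  · intro hz
    exact ⟨⟨z, hc.trans_le hz.2.1⟩, hz, rfl⟩

/-! ### The endpoint pairs of a line configuration form a pair system -/

lemma IsGeodesicLine.isClosed {L : Set ℍ} (hL : IsGeodesicLine L) : IsClosed L := by
  obtain ⟨c, hc, rfl⟩ := hL
  exact hc.isClosedEmbedding.isClosed_range

lemma IsLineConfiguration.finite_inter_compact {𝓛 : Set (Set ℍ)} (h𝓛 : IsLineConfiguration 𝓛)
    {K : Set ℍ} (hK : IsCompact K) : {L ∈ 𝓛 | (L ∩ K).Nonempty}.Finite := by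
  refine ((h𝓛.locallyFinite.finite_nonempty_inter_compact hK).image Subtype.val).subset ?_
  rintro L ⟨hL, hne⟩
  exact ⟨⟨L, hL⟩, hne, rfl⟩

/-- The point at horocyclic distance `θ` from `axisPoint t`. -/
noncomputable def offAxisPoint (θ t : ℝ) : ℍ :=
  .mk ⟨Real.exp t * θ, Real.exp t⟩ (Real.exp_pos t)

@[simp] lemma offAxisPoint_re (θ t : ℝ) : (offAxisPoint θ t).re = Real.exp t * θ := rfl

@[simp] lemma offAxisPoint_im (θ t : ℝ) : (offAxisPoint θ t).im = Real.exp t := rfl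

lemma dist_offAxisPoint_le {θ : ℝ} (hθ : 0 ≤ θ) (t : ℝ) :
    dist (offAxisPoint θ t) (axisPoint t) ≤ θ := by
  refine (dist_le_dist_coe_div_sqrt _ _).trans_eq ?_
  have h : ((offAxisPoint θ t : ℍ) : ℂ) - (axisPoint t : ℍ) = ((Real.exp t * θ : ℝ) : ℂ) := by
    apply Complex.ext <;> simp [Complex.exp_ofReal_re]
  have hE := Real.exp_pos t
  rw [Complex.dist_eq, h, Complex.norm_real, Real.norm_eq_abs, abs_of_nonneg (by positivity),
    offAxisPoint_im, axisPoint_im, Real.sqrt_mul_self hE.le]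
  field_simp

/-- A line disjoint from all other lines of the configuration could be pushed to one side, by an
amount smaller than the distance to the other lines. The resulting curve would be an unbounded
connected subset of the complement. -/
lemma IsLineConfiguration.exists_inter {𝓛 : Set (Set ℍ)} (h𝓛 : IsLineConfiguration 𝓛)
    {G : Set ℍ} (hG : IsGeodesicLine G) : ∃ L ∈ 𝓛, G ≠ L ∧ (G ∩ L).Nonempty := by
  by_contra! H
  obtain ⟨g, rfl⟩ := isGeodesicLine_iff.1 hG
  set G : Set ℍ := (fun z => g • z) '' axis
  have hF : IsClosed (⋃₀ (𝓛 \ {G})) := by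
    rw [sUnion_eq_iUnion]
    refine LocallyFinite.isClosed_iUnion ?_ fun L => (h𝓛.geodesic _ L.2.1).isClosed
    exact h𝓛.locallyFinite.comp_injective
      (g := fun L : (𝓛 \ {G} : Set (Set ℍ)) => (⟨L, L.2.1⟩ : 𝓛))
      fun L L' h => Subtype.ext (congrArg (fun M : 𝓛 => (M : Set ℍ)) h)
  have hmemG : ∀ t, g • axisPoint t ∈ G := fun t => mem_image_of_mem _ (axisPoint_re t)
  have hcont : Continuous fun t => g • axisPoint t :=
    ((isometry_smul ℍ g).comp isometry_axisPoint).continuous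
  have hdisj : ∀ z ∈ G, z ∉ ⋃₀ (𝓛 \ {G}) := by
    rintro z hz ⟨L, ⟨hL, hLG⟩, hzL⟩
    exact notMem_empty z (H L hL (fun h => hLG h.symm) ▸ ⟨hz, hzL⟩)
  obtain ⟨θ, hθc, hθpos, hθ⟩ : ∃ θ : ℝ → ℝ, Continuous θ ∧ (∀ t, 0 < θ t) ∧
      ∀ t z, dist z (g • axisPoint t) ≤ θ t → z ∉ ⋃₀ (𝓛 \ {G}) := by
    rcases (⋃₀ (𝓛 \ {G})).eq_empty_or_nonempty with he | hne
    · exact ⟨fun _ => 1, continuous_const, fun _ => one_pos, fun _ z _ => he ▸ notMem_empty z⟩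
    · have hpos : ∀ t, 0 < Metric.infDist (g • axisPoint t) (⋃₀ (𝓛 \ {G})) := fun t =>
        (hF.notMem_iff_infDist_pos hne).1 (hdisj _ (hmemG t))
      refine ⟨fun t => Metric.infDist (g • axisPoint t) (⋃₀ (𝓛 \ {G})) / 2,
        ((Metric.continuous_infDist_pt _).comp hcont).div_const 2, fun t => half_pos (hpos t), ?_⟩
      intro t z hz hzF
      have := Metric.infDist_le_dist_of_mem (x := g • axisPoint t) hzF
      rw [dist_comm] at this
      linarith [hpos t]
  have hq : Continuous fun t => g • offAxisPoint (θ t) t := by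
    refine (isometry_smul ℍ g).continuous.comp (Continuous.upperHalfPlaneMk ?_ _)
    have : Continuous fun t => ((Real.exp t * θ t : ℝ) : ℂ) + (Real.exp t : ℝ) * Complex.I := by
      fun_prop
    refine this.congr fun t => ?_
    apply Complex.ext <;> simp [Complex.exp_ofReal_re]
  have hqmem : range (fun t => g • offAxisPoint (θ t) t) ⊆ (⋃₀ 𝓛)ᶜ := by
    rintro _ ⟨t, rfl⟩ ⟨L, hL, hmem⟩
    by_cases hLG : L = G
    · rw [hLG] at hmem
      obtain ⟨w, hw, hw'⟩ := hmem
      have hw'' : w = offAxisPoint (θ t) t := MulAction.injective g hw'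
      rw [hw''] at hw
      exact (mul_pos (Real.exp_pos t) (hθpos t)).ne' hw
    · refine hθ t (g • offAxisPoint (θ t) t) ?_ ⟨L, ⟨hL, hLG⟩, hmem⟩
      rw [dist_smul]
      exact dist_offAxisPoint_le (hθpos t).le t
  have hbdd := (h𝓛.bounded _ (hqmem ⟨0, rfl⟩)).subset
    ((isPreconnected_range hq).subset_connectedComponentIn ⟨0, rfl⟩ hqmem)
  obtain ⟨C, hC⟩ := Metric.isBounded_iff.1 hbdd
  have h1 := hC ⟨|C| + 1, rfl⟩ ⟨0, rfl⟩
  rw [dist_smul] at h1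
  have h2 := (dist_log_im_le _ _).trans h1
  rw [offAxisPoint_im, offAxisPoint_im, Real.log_exp, Real.log_exp, Real.dist_eq, sub_zero,
    abs_of_nonneg (by positivity)] at h2
  linarith [le_abs_self C]

/-- Near a pair of distinct boundary points there are the endpoints of only finitely many lines. -/
lemma IsLineConfiguration.exists_nhds_finite {𝓛 : Set (Set ℍ)} (h𝓛 : IsLineConfiguration 𝓛)
    {a b : Boundary} (hab : a ≠ b) : ∃ V ∈ 𝓝 (a, b),
      {p ∈ idealPairs 𝓛 | ∃ x ∈ p, ∃ y ∈ p, (x, y) ∈ V}.Finite := by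
  obtain ⟨m, ha, hb⟩ := exists_smul_eq_zero_infty hab
  set I : Set Boundary := ((↑) : ℝ → Boundary) '' Ioo (-1 / 2) (1 / 2)
  have hI : IsOpen I := OnePoint.isOpen_image_coe.2 isOpen_Ioo
  have hI0 : ((0 : ℝ) : Boundary) ∈ I := ⟨0, by norm_num, rfl⟩
  have hswap : swapGL ℝ • (∞ : Boundary) = ((0 : ℝ) : Boundary) := by
    simp [OnePoint.smul_infty_eq_ite, swapGL]
  have hswap' : swapGL ℝ • ((0 : ℝ) : Boundary) = ∞ := by
    simp [OnePoint.smul_some_eq_ite, swapGL]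
  have hswapI : ∀ x ∈ I, swapGL ℝ • x ∉ I := by
    rintro _ ⟨x, hx, rfl⟩ ⟨y, hy, hxy⟩
    rw [OnePoint.smul_some_eq_ite] at hxy
    by_cases hx0 : x = 0
    · simp [swapGL, hx0] at hxy
    · simp [swapGL, hx0] at hxy
      have : y * x = 1 := by rw [hxy, inv_mul_cancel₀ hx0]
      nlinarith [hx.1, hx.2, hy.1, hy.2]
  -- after moving `a` to `0` and `b` to `∞`, lines with endpoints in `V` meet a compact set
  refine ⟨{v | m • v.1 ∈ I ∧ swapGL ℝ • m • v.2 ∈ I}, ?_, ?_⟩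
  · refine (IsOpen.inter (hI.preimage ?_) (hI.preimage ?_)).mem_nhds ⟨?_, ?_⟩
    · exact (continuous_const_smul m).comp continuous_fst
    · exact (continuous_const_smul (swapGL ℝ)).comp ((continuous_const_smul m).comp continuous_snd)
    · rwa [mem_preimage, ha]
    · rwa [mem_preimage, hb, hswap]
  · have hK := (isCompact_re_im_Icc (-1) 1 (c := 1 / 2) (d := 2) (by norm_num)).image
      (continuous_const_smul m⁻¹)
    refine ((h𝓛.finite_inter_compact hK).image ideal).subset ?_
    rintro _ ⟨⟨L, hL, rfl⟩, x, hx, y, hy, hx', hy'⟩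
    refine ⟨L, ⟨hL, ?_⟩, rfl⟩
    obtain ⟨g, hg, hgx, hgy⟩ : ∃ g : GL (Fin 2) ℝ, L = (fun z => g • z) '' axis ∧
        x = g • ((0 : ℝ) : Boundary) ∧ y = g • (∞ : Boundary) := by
      obtain ⟨g, hg⟩ := isGeodesicLine_iff.1 (h𝓛.geodesic L hL)
      rw [hg, ideal_smul_axis] at hx hy
      have hxy : x ≠ y := fun h => by
        rw [← h] at hy'
        exact hswapI _ hx' hy'
      rcases hx with hx | hx <;> rcases hy with hy | hy
      · exact absurd (hx.trans hy.symm) hxy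
      · exact ⟨g, hg, hx, hy⟩
      · refine ⟨g * swapGL ℝ, ?_, ?_, ?_⟩
        · have : (fun z : ℍ => swapGL ℝ • z) '' axis = axis :=
            smul_axis_eq_of_zero _ (Or.inr ⟨by simp [swapGL], by simp [swapGL]⟩)
          rw [hg]
          conv_lhs => rw [← this]
          simp [image_image, mul_smul]
        · rw [mul_smul, hswap', hx]
        · rw [mul_smul, hswap, hy]
      · exact absurd (hx.trans hy.symm) hxy
    rw [hgx, smul_smul] at hx'
    rw [hgy, smul_smul m] at hy'
    obtain ⟨t, ht⟩ := exists_smul_axisPoint_mem hx' hy'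
    refine ⟨g • axisPoint t, ?_, (m * g) • axisPoint t, ht, ?_⟩
    · rw [hg]
      exact mem_image_of_mem _ (axisPoint_re t)
    · simp [mul_smul]

theorem IsLineConfiguration.isPairSystem {𝓛 : Set (Set ℍ)} (h𝓛 : IsLineConfiguration 𝓛) :
    IsPairSystem (idealPairs 𝓛) where
  pair := by
    rintro _ ⟨L, hL, rfl⟩
    obtain ⟨g, rfl⟩ := isGeodesicLine_iff.1 (h𝓛.geodesic L hL)
    exact ⟨_, _, (MulAction.injective g).ne (OnePoint.coe_ne_infty _), ideal_smul_axis g⟩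
  finite A B hA hB hAB := by
    suffices {p ∈ idealPairs 𝓛 | ∃ x ∈ p, ∃ y ∈ p, (x, y) ∈ A ×ˢ B}.Finite by
      refine this.subset ?_
      rintro p ⟨hp, ⟨x, hx, hxA⟩, ⟨y, hy, hyB⟩⟩
      exact ⟨hp, x, hx, y, hy, hxA, hyB⟩
    refine (hA.isCompact.prod hB.isCompact).induction_on
      (p := fun S => {p ∈ idealPairs 𝓛 | ∃ x ∈ p, ∃ y ∈ p, (x, y) ∈ S}.Finite) ?_ ?_ ?_ ?_
    · simp
    · intro S T hST hT
      refine hT.subset ?_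
      rintro p ⟨hp, x, hx, y, hy, h⟩
      exact ⟨hp, x, hx, y, hy, hST h⟩
    · intro S T hS hT
      refine (hS.union hT).subset ?_
      rintro p ⟨hp, x, hx, y, hy, h | h⟩
      · exact Or.inl ⟨hp, x, hx, y, hy, h⟩
      · exact Or.inr ⟨hp, x, hx, y, hy, h⟩
    · rintro ⟨a, b⟩ ⟨ha, hb⟩
      obtain ⟨V, hV, hfin⟩ := h𝓛.exists_nhds_finite (hAB.ne_of_mem ha hb)
      exact ⟨V, mem_nhdsWithin_of_mem_nhds hV, hfin⟩
  cross a b hab := by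
    obtain ⟨G, hG, hGi⟩ := exists_geodesicLine_ideal_eq hab
    obtain ⟨L, hL, h⟩ := h𝓛.exists_inter hG
    exact ⟨ideal L, mem_image_of_mem _ hL, hGi ▸ (linked_ideal_iff hG (h𝓛.geodesic L hL)).2 h⟩
  symm := by
    rintro _ ⟨L, hL, rfl⟩ _ ⟨L', hL', rfl⟩ h
    rw [linked_ideal_iff (h𝓛.geodesic L hL) (h𝓛.geodesic L' hL')] at h
    rw [linked_ideal_iff (h𝓛.geodesic L' hL') (h𝓛.geodesic L hL), inter_comm]
    exact ⟨h.1.symm, h.2⟩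

/-! ### Boundary maps -/

lemma boundaryToSphere_mem_closure_range (ξ : Boundary) :
    boundaryToSphere ξ ∈ closure (range toSphere) := by
  obtain ⟨η, hη⟩ := exists_ne ξ
  obtain ⟨L, -, hL⟩ := exists_geodesicLine_ideal_eq hη.symm
  have : ξ ∈ ideal L := hL ▸ mem_insert _ _
  exact closure_mono (image_subset_range _ _) this

lemma isBoundaryMap_iff {γ : ℍ ≃ᵢ ℍ} {g : GL (Fin 2) ℝ} (hg : ∀ z, γ z = g • z)
    {f : Boundary ≃ₜ Boundary} : IsBoundaryMap γ f ↔ f = boundaryHomeo g := by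
  have key : IsBoundaryMap γ (boundaryHomeo g) := fun ξ => by
    have := ((sphereHomeo g).continuous.tendsto (boundaryToSphere ξ)).comp
      (tendsto_comap (f := toSphere))
    rw [sphereHomeo_boundaryToSphere] at this
    refine this.congr fun z => ?_
    rw [Function.comp_apply, sphereHomeo_toSphere, hg]
  refine ⟨fun h => ?_, fun h => h ▸ key⟩
  ext ξ
  have : (comap toSphere (𝓝 (boundaryToSphere ξ))).NeBot := by
    rw [comap_neBot_iff]
    intro t ht
    obtain ⟨_, h1, z, rfl⟩ := mem_closure_iff_nhds.1 (boundaryToSphere_mem_closure_range ξ) t ht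
    exact ⟨z, h1⟩
  exact boundaryToSphere_injective (tendsto_nhds_unique (h ξ) (key ξ))

lemma existsUnique_isBoundaryMap (γ : ℍ ≃ᵢ ℍ) : ∃! f : Boundary ≃ₜ Boundary, IsBoundaryMap γ f := by
  obtain ⟨g, hg⟩ := exists_smul_eq_isometry γ
  exact ⟨boundaryHomeo g, (isBoundaryMap_iff hg).2 rfl, fun f hf => (isBoundaryMap_iff hg).1 hf⟩

lemma IsBoundaryMap.ideal_image {γ : ℍ ≃ᵢ ℍ} {f : Boundary ≃ₜ Boundary} (hf : IsBoundaryMap γ f)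
    (A : Set ℍ) : ideal (γ '' A) = f '' ideal A := by
  obtain ⟨g, hg⟩ := exists_smul_eq_isometry γ
  rw [(isBoundaryMap_iff hg).1 hf, image_congr fun z _ => hg z, ideal_smul]
  rfl

/-- The boundary maps of the members of a group of isometries. -/
noncomputable def boundaryGroup (Γ : Subgroup (ℍ ≃ᵢ ℍ)) : Subgroup (Boundary ≃ₜ Boundary) where
  carrier := {f | ∃ γ ∈ Γ, IsBoundaryMap γ f}
  one_mem' := by
    refine ⟨1, Γ.one_mem, (isBoundaryMap_iff (g := 1) fun z => (one_smul _ z).symm).2 ?_⟩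
    ext ξ
    exact (one_smul (GL (Fin 2) ℝ) ξ).symm
  mul_mem' := by
    rintro f₁ f₂ ⟨γ₁, h₁, hf₁⟩ ⟨γ₂, h₂, hf₂⟩
    obtain ⟨g₁, hg₁⟩ := exists_smul_eq_isometry γ₁
    obtain ⟨g₂, hg₂⟩ := exists_smul_eq_isometry γ₂
    refine ⟨γ₁ * γ₂, Γ.mul_mem h₁ h₂, (isBoundaryMap_iff (g := g₁ * g₂) fun z => ?_).2 ?_⟩
    · rw [mul_smul, ← hg₂, ← hg₁]
      rfl
    · rw [(isBoundaryMap_iff hg₁).1 hf₁, (isBoundaryMap_iff hg₂).1 hf₂]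
      ext ξ
      exact (mul_smul g₁ g₂ ξ).symm
  inv_mem' := by
    rintro f ⟨γ, h, hf⟩
    obtain ⟨g, hg⟩ := exists_smul_eq_isometry γ
    refine ⟨γ⁻¹, Γ.inv_mem h, (isBoundaryMap_iff (g := g⁻¹) fun z => ?_).2 ?_⟩
    · rw [eq_inv_smul_iff, ← hg]
      exact γ.apply_symm_apply z
    · rw [(isBoundaryMap_iff hg).1 hf]
      rfl

lemma boundaryGroup_le_homeoStab {𝓛 : Set (Set ℍ)} {Γ : Subgroup (ℍ ≃ᵢ ℍ)}
    (h : Stabilizes Γ 𝓛) : boundaryGroup Γ ≤ homeoStab (idealPairs 𝓛) := by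
  rintro f ⟨γ, hγ, hf⟩
  change (fun p : Set Boundary => f '' p) '' (ideal '' 𝓛) = ideal '' 𝓛
  conv_rhs => rw [← h γ hγ]
  simp only [image_image, hf.ideal_image]

/-! ### Finiteness of the index -/

/-- Members `g` of the stabilizer are determined by their values on the endpoints of two
intersecting lines. As `g` moves these to the endpoints of two other intersecting lines, whose
intersection point can be moved to the compact set `K` by a lattice element, there are only finitely
many values up to the action of the lattice. -/
theorem finiteIndex_boundaryGroup {𝓛 : Set (Set ℍ)} {Γ : Subgroup (ℍ ≃ᵢ ℍ)}
    (h𝓛 : IsLineConfiguration 𝓛) (hΓ : IsCocompactLattice Γ) (hΓ𝓛 : Stabilizes Γ 𝓛) :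
    ((boundaryGroup Γ).subgroupOf (homeoStab (idealPairs 𝓛))).FiniteIndex := by
  have hP := h𝓛.isPairSystem
  obtain ⟨p₁, hp₁, -⟩ := hP.cross ((0 : ℝ) : Boundary) ∞ (OnePoint.coe_ne_infty _)
  obtain ⟨p₂, hp₂, hl⟩ : ∃ p₂ ∈ idealPairs 𝓛, Linked p₁ p₂ := by
    obtain ⟨a, b, hab, rfl⟩ := hP.pair p₁ hp₁
    exact hP.cross a b hab
  obtain ⟨K, hK, hcov⟩ := hΓ.cocompact
  have hpfin : ∀ p ∈ idealPairs 𝓛, p.Finite := fun p hp => by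
    obtain ⟨a, b, -, rfl⟩ := hP.pair p hp
    exact toFinite _
  let E : Set Boundary := ⋃ L ∈ {L ∈ 𝓛 | (L ∩ K).Nonempty}, ideal L
  have hE : E.Finite := (h𝓛.finite_inter_compact hK).biUnion fun L hL =>
    hpfin _ (mem_image_of_mem _ hL.1)
  have hmove : ∀ g ∈ homeoStab (idealPairs 𝓛), ∃ f ∈ boundaryGroup Γ,
      ∀ x ∈ p₁ ∪ p₂, f (g x) ∈ E := by
    intro g hg
    have hg' : ∀ p ∈ idealPairs 𝓛, g '' p ∈ idealPairs 𝓛 := fun p hp => by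
      have hg : (fun p : Set Boundary => g '' p) '' idealPairs 𝓛 = idealPairs 𝓛 := hg
      rw [← hg]
      exact mem_image_of_mem _ hp
    obtain ⟨L₁, hL₁, hi₁⟩ := hg' p₁ hp₁
    obtain ⟨L₂, hL₂, hi₂⟩ := hg' p₂ hp₂
    have hlg := hl.image g
    rw [← hi₁, ← hi₂, linked_ideal_iff (h𝓛.geodesic _ hL₁) (h𝓛.geodesic _ hL₂)] at hlg
    obtain ⟨-, z, hz₁, hz₂⟩ := hlg
    have hz : z ∈ ⋃ γ ∈ Γ, (γ : ℍ → ℍ) '' K := hcov ▸ mem_univ z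
    simp only [mem_iUnion] at hz
    obtain ⟨γ, hγ, w, hw, rfl⟩ := hz
    obtain ⟨f, hf, -⟩ := existsUnique_isBoundaryMap γ⁻¹
    have hmem : ∀ L ∈ 𝓛, γ w ∈ L → ∀ x ∈ ideal L, f x ∈ E := by
      intro L hL hwL x hx
      have h1 : (γ⁻¹ : ℍ ≃ᵢ ℍ) '' L ∈ 𝓛 := by
        rw [← hΓ𝓛 γ⁻¹ (Γ.inv_mem hγ)]
        exact mem_image_of_mem _ hL
      refine mem_biUnion (show (γ⁻¹ : ℍ ≃ᵢ ℍ) '' L ∈ {L ∈ 𝓛 | (L ∩ K).Nonempty} from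
        ⟨h1, w, ⟨γ w, hwL, γ.symm_apply_apply w⟩, hw⟩) ?_
      rw [hf.ideal_image]
      exact mem_image_of_mem _ hx
    refine ⟨f, ⟨γ⁻¹, Γ.inv_mem hγ, hf⟩, ?_⟩
    rintro x (hx | hx)
    · exact hmem L₁ hL₁ hz₁ _ (hi₁ ▸ mem_image_of_mem _ hx)
    · exact hmem L₂ hL₂ hz₂ _ (hi₂ ▸ mem_image_of_mem _ hx)
  choose! f hfΓ hfE using hmove
  -- `f g` is the element of the boundary group which moves the values of `g` into `E`
  have : Finite (p₁ ∪ p₂ : Set Boundary) := ((hpfin _ hp₁).union (hpfin _ hp₂)).to_subtype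
  have : Finite E := hE.to_subtype
  -- a coset `g H` is sent to the values of a translate of `g⁻¹` by an element of `H`
  let φ : homeoStab (idealPairs 𝓛) ⧸ (boundaryGroup Γ).subgroupOf (homeoStab (idealPairs 𝓛)) →
      ((p₁ ∪ p₂ : Set Boundary) → E) := fun q x =>
    ⟨f (q.out⁻¹).1 ((q.out⁻¹).1 x),
      hfE _ (q.out⁻¹).2 x x.2⟩
  have hφ : Function.Injective φ := by
    intro q q' h
    rw [← Quotient.out_eq' q, ← Quotient.out_eq' q', QuotientGroup.eq, Subgroup.mem_subgroupOf]
    have hs := (q.out⁻¹).2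
    have hs' := (q'.out⁻¹).2
    set s : Boundary ≃ₜ Boundary := (q.out⁻¹).1
    set s' : Boundary ≃ₜ Boundary := (q'.out⁻¹).1
    have hval : ∀ x ∈ p₁ ∪ p₂, f s (s x) = f s' (s' x) := fun x hx =>
      congrArg Subtype.val (congrFun h ⟨x, hx⟩)
    have hle := boundaryGroup_le_homeoStab hΓ𝓛
    have hmem : (f s' * s')⁻¹ * (f s * s) ∈ homeoStab (idealPairs 𝓛) :=
      mul_mem (inv_mem (mul_mem (hle (hfΓ _ hs')) hs')) (mul_mem (hle (hfΓ _ hs)) hs)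
    have hfix : ∀ x ∈ p₁ ∪ p₂, ((f s' * s')⁻¹ * (f s * s)) x = x := fun x hx => by
      change (f s' * s').symm (f s (s x)) = x
      rw [hval x hx]
      exact (f s' * s').symm_apply_apply x
    have hone := hP.eq_one_of_fixed hmem hp₁ hp₂ hl (fun x hx => hfix x (Or.inl hx))
      fun x hx => hfix x (Or.inr hx)
    have heq : f s' * s' = f s * s := inv_mul_eq_one.1 hone
    have : s * s'⁻¹ = (f s)⁻¹ * f s' := by
      rw [eq_inv_mul_iff_mul_eq, ← mul_assoc, ← heq, mul_inv_cancel_right]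
    have hgoal : s * s'⁻¹ ∈ boundaryGroup Γ :=
      this ▸ mul_mem (inv_mem (hfΓ _ hs)) (hfΓ _ hs')
    simpa [s, s'] using hgoal
  have := Finite.of_injective φ hφ
  exact Subgroup.finiteIndex_of_finite_quotient

end HypPlane

theorem mainTheorem11 (𝓛 : Set (Set ℍ)) (Γ : Subgroup (ℍ ≃ᵢ ℍ))
    (h𝓛 : HypPlane.IsLineConfiguration 𝓛)
    (hΓ : HypPlane.IsCocompactLattice Γ)
    (hΓ𝓛 : HypPlane.Stabilizes Γ 𝓛) :
    (∀ L₁ ∈ 𝓛, ∀ L₂ ∈ 𝓛, L₁ ≠ L₂ → (L₁ ∩ L₂).Nonempty →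
      ∀ g ∈ HypPlane.homeoStab (HypPlane.idealPairs 𝓛),
        (∀ ξ ∈ HypPlane.ideal L₁ ∪ HypPlane.ideal L₂, g ξ = ξ) → g = 1) ∧
    (∀ γ ∈ Γ, ∃! f : HypPlane.Boundary ≃ₜ HypPlane.Boundary, HypPlane.IsBoundaryMap γ f) ∧
    (∃ H : Subgroup (HypPlane.Boundary ≃ₜ HypPlane.Boundary),
      (H : Set (HypPlane.Boundary ≃ₜ HypPlane.Boundary)) =
          {f | ∃ γ ∈ Γ, HypPlane.IsBoundaryMap γ f} ∧
        H ≤ HypPlane.homeoStab (HypPlane.idealPairs 𝓛) ∧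
        (H.subgroupOf (HypPlane.homeoStab (HypPlane.idealPairs 𝓛))).FiniteIndex) := by
  refine ⟨?_, fun γ _ => HypPlane.existsUnique_isBoundaryMap γ, HypPlane.boundaryGroup Γ, rfl,
    HypPlane.boundaryGroup_le_homeoStab hΓ𝓛, HypPlane.finiteIndex_boundaryGroup h𝓛 hΓ hΓ𝓛⟩
  intro L₁ hL₁ L₂ hL₂ hne hint g hg hfix
  exact h𝓛.isPairSystem.eq_one_of_fixed hg (Set.mem_image_of_mem _ hL₁)
    (Set.mem_image_of_mem _ hL₂)
    ((HypPlane.linked_ideal_iff (h𝓛.geodesic _ hL₁) (h𝓛.geodesic _ hL₂)).2 ⟨hne, hint⟩)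
    (fun x hx => hfix x (Or.inl hx)) fun x hx => hfix x (Or.inr hx)
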